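/- **Modular links and labelled words.** A modular link $L$ is given by a collection of $c\ge 1$ labelled words $$x_{1}^{k_1}y_1^{l_1}\cdots x_{n_1}^{k_{n_1}}y_{n_1}^{l_{n_1}},\ \ x_{n_1+1}^{k_{n_1+1}}y_{n_1+1}^{l_{n_1+1}}\cdots,\ \ \ldots$$ with positive exponents, each primitive (not a proper power) and no two cyclic permutations of each other; subscripts are cyclic within each word, $\overline n$ is the total number of subscripts, $d_1<\dots<d_{\#k}$ are the distinct $x$-exponents and $a_1<\dots<a_{\#l}$ the distinct $y$-exponents of all words. $L$ is realised in the Lorenz template: the branch line is $[0,1]$ with return map $s\mapsto 2s \bmod 1$, and the turn belonging to a letter starts at the point whose binary digits ($x=0$, $y=1$) are that letter and the letters that follow it along the link. The order within the full $x$-bunch, $(x_{\sigma(1)},\dots,x_{\sigma(\overline n)})$, lists the $x$-bases from left to right by the starting points of the last letters of the blocks $x_i^{k_i}$; the order within the full $y$-bunch, $(y_{\tau(1)},\dots,y_{\tau(\overline n)})$, lists the $y$-bases from left to right by the starting points of the last letters of the blocks $y_i^{l_i}$. **Base orders.** The $x$-base order of $L$ is the set of $c$ tuples, one for each word $w$,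 whose entries are, for $d=d_{\#k},\dots,d_1$, the set of $x$-bases of $w$ with exponent $d$; the $y$-base order is the analogous set with the $y$-exponents in the order $a_1,\dots,a_{\#l}$. Two links have the same base orders if, after reordering the words and cyclically permuting each word of one of them (which relabels $x$- and $y$-bases simultaneously), their $x$-base orders coincide and their $y$-base orders coincide. **The link $\mathcal L_{\mathrm{SF}}$ and the trefoil $T$.** Let $U\subset S^3$ be an unknot and identify $S^3\setminus U$ with $\mathbb R^2\times S^1$, the plane being an open disc bounded by $U$, seen from above. Let the annulus $A^x_{d_j}$ be $(\{-j\}\times[-2,-1])\times S^1$ for $1\le j\le \#k$ and $A^y_{a_j}$ be $(\{j\}\times[1,2])\times S^1$ for $1\le j\le\#l$. $\mathcal L_{\mathrm{SF}}$ consists of $U$ and the boundary circles of all these annuli. $T$ is the trefoil lying above the level of the parent link, with projection to the disc the closed polygon with successive vertices $(-\tfrac12,0)$, $(\tfrac12,0)$, $(\tfrac12,\tfrac52)$, $(-\#k-2,\tfrac52)$, $(-\#k-2,-3)$, $(0,-3)$, $(0,3)$, $(\#l+2,3)$, $(\#l+2,-\tfrac12)$, $(-\tfrac12,-\tfrac12)$;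 the edge from $(0,-3)$ to $(0,3)$ goes under the edge through the origin and over the two other edges that it crosses. **Parent link.** A parent link $L_{\mathrm p}\subset S^3\setminus(\mathcal L_{\mathrm{SF}}\cup T)$ of $L$ is a link obtained as follows. Draw in the disc horizontal segments labelled $y_{\tau(1)},\dots,y_{\tau(\overline n)}$ from top to bottom at heights in $(1,2)$, and horizontal segments labelled $x_{\sigma(1)},\dots,x_{\sigma(\overline n)}$ from bottom to top at heights in $(-2,-1)$. The $x_i$-segment crosses exactly the $x$-annuli $A^x_{d}$ with $d\le k_i$, ending on the left between the last of them and the next one, and the $y_i$-segment crosses exactly the $y$-annuli $A^y_a$ with $a\le l_i$, ending on the right between the last of them and the next one. On its right the $x_i$-segment is extended to a point vertically below the right endpoint of the $y_i$-segment, and on its left the $y_i$-segment is extended to a point vertically above the left endpoint of the $x_{i+1}$-segment; these pairs of points are joined by vertical segments. An $x$-arc ($y$-arc) is an $x_i$-segment ($y_i$-segment) followed by the vertical segment that joins it to the $y_i$-segment ($x_{i+1}$-segment). The endpoints are chosen so that distinct $x$-arcs whose vertical segments approach the same $y$-annulus (equal $l_i$) are disjoint in the diagram, and distinct $y$-arcs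 whose vertical segments approach the same $x$-annulus (equal $k_{i+1}$) are disjoint in the diagram. At crossings, every $y$-arc goes under every $x$-arc, and the vertical part of an $x$-arc goes under the horizontal part of an $x$-arc. **Proposition.** Let $L_1$ and $L_2$ be two (possibly equal) modular links with the same $x$-base order and the same $y$-base order. Then $L_1$ and $L_2$ have the same link $\mathcal L_{\mathrm{SF}}$ and the same $T$, both have parent links, and every parent link of $L_1$ is ambient isotopic to every parent link of $L_2$ in $S^3\setminus(\mathcal L_{\mathrm{SF}}\cup T)$. -/

import Mathlib

open Set

noncomputable section

/-! ### Code words and modular links -/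

/-- The two letters of code words: `x` for the left ear of the Lorenz template, `y` for the right. -/
inductive Letter where
  | x : Letter
  | y : Letter

/-- The word `x^{k₀} y^{l₀} x^{k₁} y^{l₁} ⋯ x^{k_{n-1}} y^{l_{n-1}}`. -/
def codeWord {n : ℕ} (k l : Fin n → ℕ) : List Letter :=
  (List.ofFn fun j => List.replicate (k j) Letter.x ++ List.replicate (l j) Letter.y).flatten

/-- A word is primitive if it is not a proper power of another word. -/
def IsPrimitiveWord (w : List Letter) : Prop :=
  ∀ (u : List Letter) (m : ℕ), w = (List.replicate m u).flatten → m = 1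

/-- A modular link, given by a collection of labelled code words for it: `c` primitive words, each
containing both letters and written as `x^{k} y^{l} ⋯ x^{k} y^{l}` with positive exponents, that
represent pairwise distinct cyclic permutation classes. -/
structure ModularLink where
  c : ℕ
  c_pos : 0 < c
  period : Fin c → ℕ
  period_pos : ∀ i, 0 < period i
  k : (i : Fin c) → Fin (period i) → ℕ
  l : (i : Fin c) → Fin (period i) → ℕ
  k_pos : ∀ i j, 0 < k i j
  l_pos : ∀ i j, 0 < l i j
  primitive : ∀ i, IsPrimitiveWord (codeWord (k i) (l i))
  distinct : ∀ i j, i ≠ j → ¬ (codeWord (k i) (l i)).IsRotated (codeWord (k j) (l j))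

namespace ModularLink

/-- The common subscripts of the labelled `x`-bases and `y`-bases of the words. -/
abbrev Label (L : ModularLink) : Type := Σ i : Fin L.c, Fin (L.period i)

/-- Addition of `1` to a subscript, cyclically within its word. -/
def next (L : ModularLink) (a : L.Label) : L.Label := ⟨a.1, finRotate _ a.2⟩

/-- The exponent of the `x`-base with label `a`. -/
def xExp (L : ModularLink) (a : L.Label) : ℕ := L.k a.1 a.2

/-- The exponent of the `y`-base with label `a`. -/
def yExp (L : ModularLink) (a : L.Label) : ℕ := L.l a.1 a.2

/-- The set of all `x`-exponents of all words. -/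
def xExponents (L : ModularLink) : Finset ℕ := Finset.univ.image L.xExp

/-- The set of all `y`-exponents of all words. -/
def yExponents (L : ModularLink) : Finset ℕ := Finset.univ.image L.yExp

/-- The sum of the word periods. -/
def nbar (L : ModularLink) : ℕ := ∑ i, L.period i

/-! ### Base orders -/

/-- The `x`-base order of the collection of words: for every word the tuple, indexed by the distinct
`x`-exponents of the whole collection in descending order, of the sets of those `x`-bases of the
word that have the given exponent. -/
def xBaseOrder (L : ModularLink) : Set (List (Finset L.Label)) :=
  range fun i : Fin L.c => (L.xExponents.sort (· ≥ ·)).map fun d =>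
    Finset.univ.filter fun a => a.1 = i ∧ L.xExp a = d

/-- The `y`-base order of the collection of words; here the distinct `y`-exponents are listed in
ascending order. -/
def yBaseOrder (L : ModularLink) : Set (List (Finset L.Label)) :=
  range fun i : Fin L.c => (L.yExponents.sort (· ≤ ·)).map fun d =>
    Finset.univ.filter fun a => a.1 = i ∧ L.yExp a = d

/-- The two modular links have the same `x`-base order and the same `y`-base order. Base orders of
links are taken up to the order of the words and cyclic permutations of each word. A bijection of
labels that commutes with `next` is the same as a reordering of the words together with a cyclic
permutation of each word; as a permutation of labelled words it acts on the `x`-bases and on the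
`y`-bases simultaneously. -/
def SameBaseOrders (L₁ L₂ : ModularLink) : Prop :=
  ∃ e : L₁.Label ≃ L₂.Label, (∀ a, e (L₁.next a) = L₂.next (e a)) ∧
    (List.map (Finset.map e.toEmbedding)) '' L₁.xBaseOrder = L₂.xBaseOrder ∧
    (List.map (Finset.map e.toEmbedding)) '' L₁.yBaseOrder = L₂.yBaseOrder

/-! ### Position in the Lorenz template and full bunches -/

/-- `(a, x, j)` is the `(x_a, j)`-turn, where `1 ≤ j ≤ xExp a`, and `(a, y, j)` is the
`(y_a, j)`-turn, where `1 ≤ j ≤ yExp a`. -/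
abbrev Turn (L : ModularLink) : Type := L.Label × Letter × ℕ

/-- The turn that follows a given turn along the link. -/
def step (L : ModularLink) : L.Turn → L.Turn
  | (a, Letter.x, j) => if j < L.xExp a then (a, Letter.x, j + 1) else (a, Letter.y, 1)
  | (a, Letter.y, j) => if j < L.yExp a then (a, Letter.y, j + 1) else (L.next a, Letter.x, 1)

/-- `0` for `x` and `1` for `y`. -/
def _root_.Letter.bit : Letter → ℝ
  | Letter.x => 0
  | Letter.y => 1

/-- The starting point of a turn on the branch line. The branch line of the Lorenz template is the
interval `[0, 1]`, oriented from left to right; `x`-turns start in its left half, `y`-turns in its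
right half, each half being stretched by the semiflow over the whole branch line, and the first
return map is `s ↦ 2 s mod 1`. The point whose orbit under this map runs through the successive
letters of the link has these letters as its binary digits. -/
def position (L : ModularLink) (t : L.Turn) : ℝ :=
  ∑' n : ℕ, ((L.step^[n] t).2.1).bit / 2 ^ (n + 1)

/-- The starting point of the last turn of the `x_a^{k_a}`-arc; these are the turns of the full
`x`-bunch. -/
def xStart (L : ModularLink) (a : L.Label) : ℝ := L.position (a, Letter.x, L.xExp a)

/-- The starting point of the last turn of the `y_a^{l_a}`-arc; these are the turns of the full
`y`-bunch. -/
def yStart (L : ModularLink) (a : L.Label) : ℝ := L.position (a, Letter.y, L.yExp a)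

end ModularLink

/-! ### The three-sphere -/

/-- The three-sphere, as the unit sphere of `ℂ²`. -/
abbrev S3 : Type := Metric.sphere (0 : EuclideanSpace ℂ (Fin 2)) 1

/-- The vector `(e^{iθ}, a + b i) / √(1 + a² + b²)` of `ℂ²`. -/
def placeVec (p : ℝ × ℝ × ℝ) : EuclideanSpace ℂ (Fin 2) :=
  !₂[Complex.exp (p.2.2 * Complex.I) / (Real.sqrt (1 + p.1 ^ 2 + p.2.1 ^ 2) : ℂ),
     (p.1 + p.2.1 * Complex.I) / (Real.sqrt (1 + p.1 ^ 2 + p.2.1 ^ 2) : ℂ)]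

theorem placeVec_mem (p : ℝ × ℝ × ℝ) :
    placeVec p ∈ Metric.sphere (0 : EuclideanSpace ℂ (Fin 2)) 1 := by
  obtain ⟨a, b, t⟩ := p
  have h : 0 < 1 + a ^ 2 + b ^ 2 := by positivity
  have h1 : ‖Complex.exp (t * Complex.I)‖ = 1 := Complex.norm_exp_ofReal_mul_I t
  have h2 : ‖(a + b * Complex.I : ℂ)‖ ^ 2 = a ^ 2 + b ^ 2 := by
    rw [Complex.sq_norm, Complex.normSq_add_mul_I]
  have h3 : ‖((Real.sqrt (1 + a ^ 2 + b ^ 2) : ℝ) : ℂ)‖ ^ 2 = 1 + a ^ 2 + b ^ 2 := by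
    rw [Complex.norm_real, Real.norm_eq_abs, sq_abs, Real.sq_sqrt h.le]
  rw [mem_sphere_zero_iff_norm, EuclideanSpace.norm_eq, Fin.sum_univ_two]
  simp only [placeVec, PiLp.toLp_apply, Matrix.cons_val_zero, Matrix.cons_val_one, norm_div,
    div_pow, h1, h2, h3]
  rw [← add_div, one_pow, ← add_assoc, div_self h.ne', Real.sqrt_one]

/-- Coordinates on the complement of the unknot `U` in the three-sphere, which is the product of an
open disc bounded by `U`, parametrised by the plane (`a` from left to right, `b` from the front,
drawn at the bottom, to the back, drawn at the top), and a circle, parametrised by the angle `θ`.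
The disc is viewed from above: the point with the larger `θ` is the upper one. -/
def place (p : ℝ × ℝ × ℝ) : S3 := ⟨placeVec p, placeVec_mem p⟩

/-- The unknot `U`. -/
def unknotU : Set S3 := {p | p.1 0 = 0}

/-- The circle fibre over the point `(a, b)` of the disc. -/
def fibre (a b : ℝ) : Set S3 := range fun θ : ℝ => place (a, b, θ)

/-- The link `𝓛_SF` for `m` annuli in the left ear and `n` annuli in the right ear. The `j`-th
`x`-annulus, counted from the middle, consists of the fibres over the segment `{-j} × [-2, -1]` and
the `j`-th `y`-annulus, counted from the middle, of the fibres over the segment `{j} × [1, 2]`. The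
components of `𝓛_SF` are `U` and the boundary circles of all annuli. -/
def seifertLink (m n : ℕ) : Set S3 :=
  unknotU ∪ (⋃ j ∈ Icc 1 m, fibre (-j) (-2) ∪ fibre (-j) (-1)) ∪
    (⋃ j ∈ Icc 1 n, fibre j 1 ∪ fibre j 2)

/-- The closed polygon with the given vertices. -/
def closedPolygon {r : ℕ} (v : Fin r → ℝ × ℝ × ℝ) : Set (ℝ × ℝ × ℝ) :=
  ⋃ i, segment ℝ (v i) (v (finRotate r i))

/-- The trefoil knot `T` for which `S³ ∖ T` is the unit tangent bundle of the modular surface, in its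
position relative to `m` annuli in the left ear and `n` annuli in the right ear. Its
diagram in the disc has three crossings, at `(0, 5/2)`, `(0, 0)` and `(0, -1/2)`. -/
def trefoilKnot (m n : ℕ) : Set S3 :=
  place '' closedPolygon ![(-1/2, 0, 4), (1/2, 0, 4), (1/2, 5/2, 2), (-(m + 2), 5/2, 2),
    (-(m + 2), -3, 2), (0, -3, 3), (0, 3, 3), (n + 2, 3, 2), (n + 2, -1/2, 2), (-1/2, -1/2, 2)]

/-! ### Parent links -/

namespace ModularLink

/-- The link `𝓛_SF` of `L`: one annulus for each distinct exponent. The `j`-th annulus counted from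
the middle belongs to the `j`-th smallest exponent. -/
def sfLink (L : ModularLink) : Set S3 := seifertLink L.xExponents.card L.yExponents.card

/-- The trefoil knot `T` in its position relative to the annuli of `L`. -/
def trefoil (L : ModularLink) : Set S3 := trefoilKnot L.xExponents.card L.yExponents.card

/-- The number `j` such that `k_a` is the `j`-th smallest `x`-exponent. -/
def xRank (L : ModularLink) (a : L.Label) : ℕ := (L.xExponents.filter (· ≤ L.xExp a)).card

/-- The number `j` such that `l_a` is the `j`-th smallest `y`-exponent. -/
def yRank (L : ModularLink) (a : L.Label) : ℕ := (L.yExponents.filter (· ≤ L.yExp a)).card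

/-- The part of the diagram of a parent link in the disc with label `x_a`: a horizontal segment at
height `hx a`, from the column `cx a` on the left to the column `cy a` on the right, and the vertical
segment that joins it to the `y_a`-segment. -/
def xArc (L : ModularLink) (hx hy cx cy : L.Label → ℝ) (a : L.Label) : Set (ℝ × ℝ) :=
  segment ℝ (cx a, hx a) (cy a, hx a) ∪ segment ℝ (cy a, hx a) (cy a, hy a)

/-- The part of the diagram of a parent link in the disc with label `y_a`: a horizontal segment at
height `hy a`, from the column `cy a` on the right to the column `cx (next a)` on the left, and the
vertical segment that joins it to the `x_{a+1}`-segment. -/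
def yArc (L : ModularLink) (hx hy cx cy : L.Label → ℝ) (a : L.Label) : Set (ℝ × ℝ) :=
  segment ℝ (cy a, hy a) (cx (L.next a), hy a) ∪
    segment ℝ (cx (L.next a), hy a) (cx (L.next a), hx (L.next a))

/-- The choices made in drawing a parent link of `L`. -/
structure ParentDiagram (L : ModularLink) where
  /-- The order within the full `x`-bunch, from left to right. -/
  σ : Fin L.nbar ≃ L.Label
  σ_order : StrictMono fun r => L.xStart (σ r)
  /-- The order within the full `y`-bunch, from left to right. -/
  τ : Fin L.nbar ≃ L.Label
  τ_order : StrictMono fun r => L.yStart (τ r)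
  /-- The height of the horizontal `x_a`-segment. -/
  hx : L.Label → ℝ
  /-- The height of the horizontal `y_a`-segment. -/
  hy : L.Label → ℝ
  /-- The column of the left endpoint of the horizontal `x_a`-segment. -/
  cx : L.Label → ℝ
  /-- The column of the right endpoint of the horizontal `y_a`-segment. -/
  cy : L.Label → ℝ
  /-- The `x`-segments are ordered from bottom to top by `σ`. -/
  hx_order : StrictMono fun r => hx (σ r)
  /-- The `y`-segments are ordered from top to bottom by `τ`. -/
  hy_order : StrictAnti fun r => hy (τ r)
  hx_mem : ∀ a, hx a ∈ Ioo (-2 : ℝ) (-1)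
  hy_mem : ∀ a, hy a ∈ Ioo (1 : ℝ) 2
  /-- The `x_a`-segment crosses exactly the `x`-annuli of the exponents that are at most `k_a`. -/
  cx_mem : ∀ a, cx a ∈ Ioo (-((L.xRank a : ℝ) + 1)) (-(L.xRank a : ℝ))
  /-- The `y_a`-segment crosses exactly the `y`-annuli of the exponents that are at most `l_a`. -/
  cy_mem : ∀ a, cy a ∈ Ioo (L.yRank a : ℝ) ((L.yRank a : ℝ) + 1)
  /-- `x`-arcs that approach the same `y`-annulus do not meet. -/
  x_disjoint : ∀ a b, a ≠ b → L.yExp a = L.yExp b →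
    Disjoint (L.xArc hx hy cx cy a) (L.xArc hx hy cx cy b)
  /-- `y`-arcs that approach the same `x`-annulus do not meet. -/
  y_disjoint : ∀ a b, a ≠ b → L.xExp (L.next a) = L.xExp (L.next b) →
    Disjoint (L.yArc hx hy cx cy a) (L.yArc hx hy cx cy b)

/-- The parent link with the given diagram. The horizontal parts of the `x`-arcs are drawn at level
`1`, the vertical parts of the `x`-arcs at level `1/2` and the `y`-arcs at level `0`, so that every
`y`-arc goes under every `x`-arc and the vertical part of an `x`-arc goes under the horizontal part of
an `x`-arc. Consecutive parts are joined by segments in the direction of the fibres. -/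
def ParentDiagram.link {L : ModularLink} (D : L.ParentDiagram) : Set S3 :=
  place '' ⋃ a : L.Label,
    segment ℝ (D.cx a, D.hx a, 1) (D.cy a, D.hx a, 1) ∪
    segment ℝ (D.cy a, D.hx a, 1) (D.cy a, D.hx a, 1/2) ∪
    segment ℝ (D.cy a, D.hx a, 1/2) (D.cy a, D.hy a, 1/2) ∪
    segment ℝ (D.cy a, D.hy a, 1/2) (D.cy a, D.hy a, 0) ∪
    segment ℝ (D.cy a, D.hy a, 0) (D.cx (L.next a), D.hy a, 0) ∪
    segment ℝ (D.cx (L.next a), D.hy a, 0) (D.cx (L.next a), D.hx (L.next a), 0) ∪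
    segment ℝ (D.cx (L.next a), D.hx (L.next a), 0) (D.cx (L.next a), D.hx (L.next a), 1)

/-- `K` is a parent link of `L`. -/
def IsParentLink (L : ModularLink) (K : Set S3) : Prop := ∃ D : L.ParentDiagram, K = D.link

end ModularLink

/-! ### Ambient isotopy -/

/-- `A` and `B` are subsets of the space `W` that are ambient isotopic in `W`. -/
def AmbientIsotopicIn {X : Type*} [TopologicalSpace X] (W A B : Set X) : Prop :=
  A ⊆ W ∧ B ⊆ W ∧ ∃ H : unitInterval → (W ≃ₜ W),
    Continuous (fun p : unitInterval × W => H p.1 p.2) ∧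
    H 0 = Homeomorph.refl W ∧
    H 1 '' ((↑) ⁻¹' A : Set W) = ((↑) ⁻¹' B : Set W)

end

/-! The base orders determine every order that enters a parent diagram, and a diagram is rigid up to
reparametrising its columns and its heights.

Orders. Between consecutive full-bunch turns the return map is affine (`xStart_eq`, `yStart_eq`).
The last `x` of a block is followed by `y`, so its start lies in `[1/4, 1/2)`; likewise the last `y`
of a block starts in `(1/2, 3/4]`. These windows are narrow enough that two starts are compared by
the following exponents; if these are equal, by the following starts, whose difference is at least
twice as large. The comparison is thus lexicographic and uses only ranks of exponents, which the
base orders record (`SameBaseOrders.exists_equiv`, `xStart_lt_of_equiv`). Primitivity and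
distinctness of the words exclude ties (`xStart_injective`).

Rigidity. The disjointness conditions force the order of the columns in each gap between annuli
(`ParentDiagram.cx_lt`, `ParentDiagram.cy_lt`). Hence two diagrams correspond under order
isomorphisms `ψ` of columns and `φ` of heights that fix the integers at which the annuli sit
(`exists_orderIso_columns`, `exists_orderIso_heights`).

Isotopy. Interpolate linearly from the identity to `ψ × φ` in the disc, damped by a cutoff in the
angle. The fibres in `seifertLink` lie over integer points and stay fixed; the parent link has
angles in `[0, 1]`, the trefoil in `[2, 4]`, so the cutoff moves the first fully and the second not
at all. -/

noncomputable section

/-! ### Starting points of full-bunch turns and their comparison. -/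

namespace ModularLink

variable (L : ModularLink)

theorem bit_nonneg (c : Letter) : 0 ≤ c.bit := by cases c <;> simp [Letter.bit]

theorem bit_le_one (c : Letter) : c.bit ≤ 1 := by cases c <;> simp [Letter.bit]

theorem hasSum_half_pow_succ : HasSum (fun n : ℕ => (1 : ℝ) / 2 ^ (n + 1)) 1 := by
  convert hasSum_geometric_two' (1 : ℝ) using 2 with n
  rw [pow_succ, div_div, mul_comm]

theorem summable_position (t : L.Turn) :
    Summable fun n : ℕ => ((L.step^[n] t).2.1).bit / 2 ^ (n + 1) := by
  refine hasSum_half_pow_succ.summable.of_nonneg_of_le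
    (fun n => div_nonneg (bit_nonneg _) (by positivity)) fun n => ?_
  gcongr
  exact bit_le_one _

theorem position_nonneg (t : L.Turn) : 0 ≤ L.position t :=
  tsum_nonneg fun _ => div_nonneg (bit_nonneg _) (by positivity)

theorem position_le_one (t : L.Turn) : L.position t ≤ 1 := by
  rw [← hasSum_half_pow_succ.tsum_eq]
  refine (L.summable_position t).tsum_le_tsum (fun n => ?_) hasSum_half_pow_succ.summable
  gcongr
  exact bit_le_one _

theorem position_eq (t : L.Turn) :
    L.position t = (t.2.1.bit + L.position (L.step t)) / 2 := by
  rw [position, (L.summable_position t).tsum_eq_zero_add, position, add_div, ← tsum_div_const]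
  simp [pow_succ, div_div]

/-- Prefixing the digit 1 is the contraction by 1/2 towards the fixed point 1; prefixing 0 contracts
towards 0 in `position_x`. -/
theorem position_y (a : L.Label) (m : ℕ) (hm : m < L.yExp a) :
    1 - L.position (a, Letter.y, L.yExp a - m) = (1 - L.yStart a) / 2 ^ m := by
  induction m with
  | zero => simp [yStart]
  | succ m ih =>
    have h := L.position_eq (a, Letter.y, L.yExp a - (m + 1))
    rw [step, if_pos (by omega), show L.yExp a - (m + 1) + 1 = L.yExp a - m by omega] at h
    have := ih (by omega)
    rw [h, pow_succ, ← div_div, ← this]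
    simp only [Letter.bit]
    ring

theorem position_x (a : L.Label) (m : ℕ) (hm : m < L.xExp a) :
    L.position (a, Letter.x, L.xExp a - m) = L.xStart a / 2 ^ m := by
  induction m with
  | zero => simp [xStart]
  | succ m ih =>
    have h := L.position_eq (a, Letter.x, L.xExp a - (m + 1))
    rw [step, if_pos (by omega), show L.xExp a - (m + 1) + 1 = L.xExp a - m by omega] at h
    have := ih (by omega)
    rw [h, pow_succ, ← div_div, ← this]
    simp only [Letter.bit]
    ring

theorem xExp_pos (a : L.Label) : 0 < L.xExp a := L.k_pos _ _

theorem yExp_pos (a : L.Label) : 0 < L.yExp a := L.l_pos _ _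

theorem xStart_eq (a : L.Label) : L.xStart a = 1 / 2 - (1 - L.yStart a) / 2 ^ L.yExp a := by
  have hp := L.yExp_pos a
  have h := L.position_y a (L.yExp a - 1) (by omega)
  rw [show L.yExp a - (L.yExp a - 1) = 1 by omega] at h
  rw [xStart, position_eq, step, if_neg (lt_irrefl _)]
  obtain ⟨n, hn⟩ : ∃ n, L.yExp a = n + 1 := ⟨L.yExp a - 1, by omega⟩
  rw [hn] at h ⊢
  rw [pow_succ, ← div_div]
  simp only [Nat.add_sub_cancel] at h
  rw [← h]
  simp only [Letter.bit]
  ring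

theorem yStart_eq (a : L.Label) :
    L.yStart a = 1 / 2 + L.xStart (L.next a) / 2 ^ L.xExp (L.next a) := by
  have hp := L.xExp_pos (L.next a)
  have h := L.position_x (L.next a) (L.xExp (L.next a) - 1) (by omega)
  rw [show L.xExp (L.next a) - (L.xExp (L.next a) - 1) = 1 by omega] at h
  rw [yStart, position_eq, step, if_neg (lt_irrefl _)]
  obtain ⟨n, hn⟩ : ∃ n, L.xExp (L.next a) = n + 1 := ⟨L.xExp (L.next a) - 1, by omega⟩
  rw [hn] at h ⊢
  rw [pow_succ, ← div_div]
  simp only [Nat.add_sub_cancel] at h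
  rw [← h]
  simp only [Letter.bit]
  ring

theorem two_le_two_pow {n : ℕ} (hn : 0 < n) : (2 : ℝ) ≤ 2 ^ n := by
  simpa using pow_le_pow_right₀ (one_le_two (α := ℝ)) hn

/-- The window bounds are bootstrapped: the weak bounds on each kind of start, fed through the two
affine relations, yield the sharp and strict ones. -/
theorem xStart_le_half (a : L.Label) : L.xStart a ≤ 1 / 2 := by
  rw [xStart_eq]
  have : 0 ≤ (1 - L.yStart a) / 2 ^ L.yExp a :=
    div_nonneg (sub_nonneg.2 (L.position_le_one _)) (by positivity)
  linarith

theorem yStart_le (a : L.Label) : L.yStart a ≤ 3 / 4 := by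
  rw [yStart_eq]
  have : L.xStart (L.next a) / 2 ^ L.xExp (L.next a) ≤ (1 / 2) / 2 :=
    div_le_div₀ (by norm_num) (L.xStart_le_half _) two_pos (two_le_two_pow (L.xExp_pos _))
  linarith

theorem half_le_yStart (a : L.Label) : 1 / 2 ≤ L.yStart a := by
  rw [yStart_eq]
  have : 0 ≤ L.xStart (L.next a) / 2 ^ L.xExp (L.next a) :=
    div_nonneg (L.position_nonneg _) (by positivity)
  linarith

theorem xStart_lt (a : L.Label) : L.xStart a < 1 / 2 := by
  rw [xStart_eq]
  have : 0 < (1 - L.yStart a) / 2 ^ L.yExp a :=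
    div_pos (by linarith [L.yStart_le a]) (by positivity)
  linarith

theorem le_xStart (a : L.Label) : 1 / 4 ≤ L.xStart a := by
  rw [xStart_eq]
  have : (1 - L.yStart a) / 2 ^ L.yExp a ≤ (1 / 2) / 2 :=
    div_le_div₀ (by norm_num) (by linarith [L.half_le_yStart a]) two_pos
      (two_le_two_pow (L.yExp_pos _))
  linarith

theorem half_lt_yStart (a : L.Label) : 1 / 2 < L.yStart a := by
  rw [yStart_eq]
  have : 0 < L.xStart (L.next a) / 2 ^ L.xExp (L.next a) :=
    div_pos (by linarith [L.le_xStart (L.next a)]) (by positivity)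
  linarith

/-- The hypotheses give `u < 2 * v`, so one extra halving of `u` outweighs any difference inside the
window. -/
theorem div_two_pow_lt {u v : ℝ} {m n : ℕ} (hu : u < 1 / 2) (hv : 1 / 4 ≤ v) (h : m < n) :
    u / 2 ^ n < v / 2 ^ m := by
  rw [div_lt_div_iff₀ (by positivity) (by positivity)]
  have h2 : (2 : ℝ) ^ m * 2 ≤ 2 ^ n := by
    rw [← pow_succ]; exact pow_le_pow_right₀ one_le_two h
  have h3 : (0 : ℝ) < 2 ^ m := by positivity
  nlinarith

theorem xStart_lt_of_yExp_lt {a b : L.Label} (h : L.yExp a < L.yExp b) :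
    L.xStart a < L.xStart b := by
  rw [xStart_eq, L.xStart_eq b]
  have := div_two_pow_lt (u := 1 - L.yStart b) (v := 1 - L.yStart a)
    (by linarith [L.half_lt_yStart b]) (by linarith [L.yStart_le a]) h
  linarith

theorem yStart_lt_of_xExp_lt {a b : L.Label} (h : L.xExp (L.next b) < L.xExp (L.next a)) :
    L.yStart a < L.yStart b := by
  rw [yStart_eq, L.yStart_eq b]
  have := div_two_pow_lt (L.xStart_lt (L.next a)) (L.le_xStart (L.next b)) h
  linarith

theorem yExp_le_of_xStart_le {a b : L.Label} (h : L.xStart a ≤ L.xStart b) :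
    L.yExp a ≤ L.yExp b :=
  not_lt.1 fun h' => (L.xStart_lt_of_yExp_lt h').not_ge h

theorem xExp_le_of_yStart_le {a b : L.Label} (h : L.yStart a ≤ L.yStart b) :
    L.xExp (L.next b) ≤ L.xExp (L.next a) :=
  not_lt.1 fun h' => (L.yStart_lt_of_xExp_lt h').not_ge h

/-- With equal exponents the affine maps agree up to translation, so a comparison passes to the next
start with its sign kept and its gap at least doubled. -/
theorem yStart_sub {a b : L.Label} (h : L.yExp a = L.yExp b) :
    L.yStart b - L.yStart a = 2 ^ L.yExp a * (L.xStart b - L.xStart a) := by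
  rw [L.xStart_eq a, L.xStart_eq b, h]
  field_simp
  ring

theorem xStart_next_sub {a b : L.Label} (h : L.xExp (L.next a) = L.xExp (L.next b)) :
    L.xStart (L.next b) - L.xStart (L.next a) =
      2 ^ L.xExp (L.next a) * (L.yStart b - L.yStart a) := by
  rw [L.yStart_eq a, L.yStart_eq b, h]
  field_simp
  ring

theorem yStart_lt_iff {a b : L.Label} (h : L.xExp (L.next a) = L.xExp (L.next b)) :
    L.yStart a < L.yStart b ↔ L.xStart (L.next a) < L.xStart (L.next b) := by
  rw [← sub_pos, ← sub_pos (b := L.xStart _), L.xStart_next_sub h]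
  exact (mul_pos_iff_of_pos_left (by positivity)).symm

end ModularLink

/-! ### Words as lists of pairs of exponents -/

/-- The word with the given list of pairs of exponents. -/
def pairWord (s : List (ℕ × ℕ)) : List Letter :=
  s.flatMap fun p => List.replicate p.1 Letter.x ++ List.replicate p.2 Letter.y

theorem pairWord_append (s t : List (ℕ × ℕ)) :
    pairWord (s ++ t) = pairWord s ++ pairWord t := by
  simp [pairWord]

theorem pairWord_flatten_replicate (m : ℕ) (s : List (ℕ × ℕ)) :
    pairWord (List.replicate m s).flatten = (List.replicate m (pairWord s)).flatten := by
  induction m with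
  | zero => simp [pairWord]
  | succ m ih => simp [List.replicate_succ, pairWord_append, ih]

theorem pairWord_isRotated {s t : List (ℕ × ℕ)} (h : s.IsRotated t) :
    (pairWord s).IsRotated (pairWord t) := by
  obtain ⟨n, rfl⟩ := h
  rw [List.rotate_eq_drop_append_take_mod]
  conv_lhs => rw [← List.take_append_drop (n % s.length) s]
  rw [pairWord_append, pairWord_append]
  exact List.isRotated_append

theorem map_range_mul {α : Type*} {g : ℕ → α} {d : ℕ} (hg : Function.Periodic g d) (m : ℕ) :
    (List.range (d * m)).map g = (List.replicate m ((List.range d).map g)).flatten := by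
  induction m with
  | zero => simp
  | succ m ih =>
    rw [Nat.mul_succ, List.range_add, List.map_append, ih, List.replicate_succ']
    simp only [List.flatten_append, List.map_map, List.flatten_singleton]
    congr 2
    funext t
    have := hg.nat_mul m t
    simp only [Function.comp_apply]
    rw [← this]
    congr 1
    simp only [Nat.cast_id]
    ring

theorem map_range_isRotated {α : Type*} {g : ℕ → α} {n : ℕ} (hg : Function.Periodic g n)
    (d : ℕ) : ((List.range n).map g).IsRotated ((List.range n).map fun t => g (t + d)) := by
  induction d with
  | zero => exact List.IsRotated.refl _
  | succ d ih =>
    refine ih.trans ?_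
    cases n with
    | zero => simp
    | succ n =>
      have h : (List.range (n + 1)).map (fun t => g (t + d)) =
          [g d] ++ (List.range n).map fun t => g (t + (d + 1)) := by
        rw [List.range_succ_eq_map]
        simp [Function.comp_def, add_assoc, add_comm 1 d]
      have h' : (List.range (n + 1)).map (fun t => g (t + (d + 1))) =
          ((List.range n).map fun t => g (t + (d + 1))) ++ [g d] := by
        rw [List.range_succ, List.map_append, ← hg d]
        simp [add_left_comm]
      rw [h, h']
      exact List.isRotated_append

/-- Periods of `g` are the periods of the point `g` under the shift on sequences, and these are
closed under gcd. -/
theorem periodic_gcd {α : Type*} {g : ℕ → α} {m n : ℕ} (hm : Function.Periodic g m)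
    (hn : Function.Periodic g n) : Function.Periodic g (m.gcd n) := by
  let S : (ℕ → α) → ℕ → α := fun f t => f (t + 1)
  have hS : ∀ d f, S^[d] f = fun t => f (t + d) := by
    intro d
    induction d with
    | zero => intro f; rfl
    | succ d ih =>
      intro f
      rw [Function.iterate_succ_apply, ih]
      funext t
      simp [S, add_assoc]
  have key : ∀ d, Function.IsPeriodicPt S d g ↔ Function.Periodic g d := fun d => by
    rw [Function.IsPeriodicPt, Function.IsFixedPt, hS, funext_iff]
    rfl
  exact (key _).1 (((key _).2 hm).gcd ((key _).2 hn))

theorem periodic_of_shift {α : Type*} {g : ℕ → α} {n d s : ℕ} (hn : 0 < n)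
    (hg : Function.Periodic g n) (hs : Function.Periodic (fun t => g (t + s)) d) :
    Function.Periodic g d := fun t => by
  have hle : s ≤ s * n := Nat.le_mul_of_pos_right s hn
  -- Going forward by `s * n - s` replaces going back by `s`: the two differ by a multiple of the
  -- period `n`.
  have h := hs (t + (s * n - s))
  simp only at h
  rw [show t + (s * n - s) + d + s = t + d + s * n by omega,
    show t + (s * n - s) + s = t + s * n by omega] at h
  have h1 := hg.nat_mul s (t + d)
  have h2 := hg.nat_mul s t
  simp only [Nat.cast_id] at h1 h2
  rw [← h1, h, h2]

/-! ### Primitivity, distinctness and injectivity of the starting points. -/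

namespace ModularLink

variable (L : ModularLink)

theorem next_injective : Function.Injective L.next := by
  rintro ⟨i, j⟩ ⟨i', j'⟩ h
  simp only [next, Sigma.mk.injEq] at h
  obtain ⟨rfl, h⟩ := h
  simpa using h

theorem next_surjective : Function.Surjective L.next :=
  Finite.surjective_of_injective L.next_injective

/-- The pairs of exponents of the `i`-th word, repeated periodically. -/
def pairSeq (i : Fin L.c) (t : ℕ) : ℕ × ℕ :=
  (L.k i ⟨t % L.period i, Nat.mod_lt _ (L.period_pos i)⟩,
    L.l i ⟨t % L.period i, Nat.mod_lt _ (L.period_pos i)⟩)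

theorem pairSeq_periodic (i : Fin L.c) : Function.Periodic (L.pairSeq i) (L.period i) :=
  fun t => by simp [pairSeq]

theorem iterate_next (i : Fin L.c) (j : Fin (L.period i)) (n : ℕ) :
    L.next^[n] ⟨i, j⟩ = ⟨i, ⟨(j + n) % L.period i, Nat.mod_lt _ (L.period_pos i)⟩⟩ := by
  induction n with
  | zero => simp [Nat.mod_eq_of_lt j.2]
  | succ n ih =>
    rw [Function.iterate_succ_apply', ih, next]
    congr 1
    have : NeZero (L.period i) := ⟨(L.period_pos i).ne'⟩
    rw [finRotate_apply]
    ext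
    rw [Fin.val_add, Fin.val_one', Nat.add_mod_mod, Nat.mod_add_mod]
    simp [add_assoc]

theorem exp_iterate_next (a : L.Label) (n : ℕ) :
    (L.xExp (L.next^[n] a), L.yExp (L.next^[n] a)) = L.pairSeq a.1 (n + a.2) := by
  obtain ⟨i, j⟩ := a
  rw [iterate_next]
  simp [pairSeq, xExp, yExp, add_comm]

theorem codeWord_eq (i : Fin L.c) :
    codeWord (L.k i) (L.l i) = pairWord ((List.range (L.period i)).map (L.pairSeq i)) := by
  rw [codeWord, pairWord, List.flatMap_def]
  congr 1
  refine List.ext_getElem (by simp) fun t h1 h2 => ?_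
  have ht : t < L.period i := by simpa using h1
  simp [pairSeq, Nat.mod_eq_of_lt ht]

/-- A proper divisor as period would exhibit the code word as a proper power. -/
theorem eq_period_of_dvd {i : Fin L.c} {d : ℕ} (hd : d ∣ L.period i)
    (h : Function.Periodic (L.pairSeq i) d) : d = L.period i := by
  obtain ⟨m, hm⟩ := hd
  have := L.primitive i (pairWord ((List.range d).map (L.pairSeq i))) m (by
    rw [codeWord_eq, hm, map_range_mul h, pairWord_flatten_replicate])
  rw [hm, this, mul_one]

theorem period_dvd {i : Fin L.c} {d : ℕ} (h : Function.Periodic (L.pairSeq i) d) :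
    L.period i ∣ d := by
  rw [← L.eq_period_of_dvd (Nat.gcd_dvd_right d _) (periodic_gcd h (L.pairSeq_periodic i))]
  exact Nat.gcd_dvd_left _ _

/-- The difference of the two subscripts is a period smaller than the word period, hence zero.
Agreement of the tails from `s` on is enough, since a periodic sequence is determined by any tail.
-/
theorem eq_of_le_of_pairSeq_eq {i : Fin L.c} {j j' : Fin (L.period i)} (hle : j ≤ j') {s : ℕ}
    (h : ∀ n, L.pairSeq i (n + s + j) = L.pairSeq i (n + s + j')) : j = j' := by
  have hper : Function.Periodic (L.pairSeq i) (j' - j : ℕ) := by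
    refine periodic_of_shift (s := s + j) (L.period_pos i) (L.pairSeq_periodic i) fun n => ?_
    have := h n
    have hle' : (j : ℕ) ≤ j' := hle
    simp only
    rw [show n + (j' - j : ℕ) + (s + j) = n + s + j' by omega, ← this, add_assoc]
  have h0 := Nat.eq_zero_of_dvd_of_lt (L.period_dvd hper) (by omega)
  have hle' : (j : ℕ) ≤ j' := hle
  ext
  omega

/-- For labels in different words, agreement of tails makes each word period divide the other, and
the two words become rotations of each other, against `distinct`. -/
theorem eq_of_pairSeq_eq {a b : L.Label} {s : ℕ}
    (h : ∀ n, L.pairSeq a.1 (n + s + a.2) = L.pairSeq b.1 (n + s + b.2)) : a = b := by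
  obtain ⟨i, j⟩ := a
  obtain ⟨i', j'⟩ := b
  simp only at h
  rcases eq_or_ne i i' with rfl | hi
  · congr 1
    rcases le_total j j' with hle | hle
    · exact L.eq_of_le_of_pairSeq_eq hle h
    · exact (L.eq_of_le_of_pairSeq_eq hle fun n => (h n).symm).symm
  · exfalso
    have hf : (fun t => L.pairSeq i (t + (s + j))) = fun t => L.pairSeq i' (t + (s + j')) := by
      funext t; simpa [add_assoc] using h t
    have sh : ∀ i (r : ℕ), Function.Periodic (fun t => L.pairSeq i (t + r)) (L.period i) :=
      fun i r t => by
        simp only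
        rw [add_right_comm, L.pairSeq_periodic]
    have h1 : L.period i ∣ L.period i' := L.period_dvd <|
      periodic_of_shift (L.period_pos i) (L.pairSeq_periodic i) (hf ▸ sh i' (s + j'))
    have h2 : L.period i' ∣ L.period i := L.period_dvd <|
      periodic_of_shift (L.period_pos i') (L.pairSeq_periodic i') (hf ▸ sh i (s + j))
    have hp := Nat.dvd_antisymm h1 h2
    refine L.distinct i i' hi ?_
    rw [codeWord_eq, codeWord_eq]
    refine pairWord_isRotated ?_
    refine (map_range_isRotated (L.pairSeq_periodic i) (s + j)).trans ?_
    rw [hf, hp]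
    exact (map_range_isRotated (L.pairSeq_periodic i') (s + j')).symm

theorem xStart_next_eq {a b : L.Label} (h : L.xStart a = L.xStart b) :
    L.yExp a = L.yExp b ∧ L.xExp (L.next a) = L.xExp (L.next b) ∧
      L.xStart (L.next a) = L.xStart (L.next b) := by
  have h1 := le_antisymm (L.yExp_le_of_xStart_le h.le) (L.yExp_le_of_xStart_le h.ge)
  have h2 := L.yStart_sub h1
  rw [h, sub_self, mul_zero, sub_eq_zero] at h2
  have h3 := le_antisymm (L.xExp_le_of_yStart_le h2.le) (L.xExp_le_of_yStart_le h2.ge)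
  have h4 := L.xStart_next_sub h3
  rw [h2, sub_self, mul_zero, sub_eq_zero] at h4
  exact ⟨h1, h3, h4.symm⟩

theorem xStart_injective : Function.Injective L.xStart := fun a b h => by
  have key : ∀ n, L.xStart (L.next^[n] a) = L.xStart (L.next^[n] b) := fun n => by
    induction n with
    | zero => exact h
    | succ n ih =>
      rw [Function.iterate_succ_apply', Function.iterate_succ_apply']
      exact (L.xStart_next_eq ih).2.2
  -- Equal starts control the `x`-exponents only from the next label on, hence the tail from 1.
  refine L.eq_of_pairSeq_eq (s := 1) fun n => ?_
  rw [← exp_iterate_next, ← exp_iterate_next, (L.xStart_next_eq (key (n + 1))).1,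
    Function.iterate_succ_apply', Function.iterate_succ_apply', (L.xStart_next_eq (key n)).2.1]

theorem yStart_injective : Function.Injective L.yStart := fun a b h => by
  have h3 := le_antisymm (L.xExp_le_of_yStart_le h.le) (L.xExp_le_of_yStart_le h.ge)
  have h4 := L.xStart_next_sub h3
  rw [h, sub_self, mul_zero, sub_eq_zero] at h4
  exact L.next_injective (L.xStart_injective h4)

/-! ### Links with the same base orders -/

end ModularLink

/-- A base order shows only the place of an exponent in the sorted list. This lemma and the next
convert that place into the rank, which no longer mentions the exponents' values. -/
theorem card_filter_le_sort_getElem (S : Finset ℕ) (p : ℕ) (hp : p < (S.sort (· ≥ ·)).length) :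
    (S.filter (· ≤ (S.sort (· ≥ ·))[p])).card = S.card - p := by
  have hl : (S.sort (· ≥ ·)).length = S.card := S.length_sort _
  have hs : (S.sort (· ≥ ·)).SortedGT := S.sortedGT_sort
  have hm : (S.filter (· ≤ (S.sort (· ≥ ·))[p])) = ((S.sort (· ≥ ·)).drop p).toFinset := by
    ext d
    simp only [Finset.mem_filter, List.mem_toFinset, List.mem_drop_iff_getElem]
    rw [← Finset.mem_sort (· ≥ ·), List.mem_iff_getElem]
    constructor
    · rintro ⟨⟨q, hq, rfl⟩, h⟩
      have : p ≤ q := by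
        by_contra hlt
        exact absurd (hs.strictAnti_get (a := ⟨q, hq⟩) (b := ⟨p, hp⟩) (by simpa using hlt))
          (by simpa using h)
      exact ⟨q - p, by omega, by simp [show p + (q - p) = q by omega]⟩
    · rintro ⟨r, hr, rfl⟩
      exact ⟨⟨p + r, by omega, rfl⟩,
        hs.strictAnti_get.antitone (a := ⟨p, hp⟩) (b := ⟨p + r, by omega⟩) (by simp)⟩
  rw [hm, List.toFinset_card_of_nodup ((S.sort_nodup _).sublist (List.drop_sublist _ _)),
    List.length_drop, hl]

theorem card_filter_le_sort_le_getElem (S : Finset ℕ) (p : ℕ)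
    (hp : p < (S.sort (· ≤ ·)).length) :
    (S.filter (· ≤ (S.sort (· ≤ ·))[p])).card = p + 1 := by
  have hs : (S.sort (· ≤ ·)).SortedLT := S.sortedLT_sort
  have hm : (S.filter (· ≤ (S.sort (· ≤ ·))[p])) = ((S.sort (· ≤ ·)).take (p + 1)).toFinset := by
    ext d
    simp only [Finset.mem_filter, List.mem_toFinset, List.mem_take_iff_getElem]
    rw [← Finset.mem_sort (· ≤ ·), List.mem_iff_getElem]
    constructor
    · rintro ⟨⟨q, hq, rfl⟩, h⟩
      have : q ≤ p := by
        by_contra hlt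
        exact absurd (hs.strictMono_get (a := ⟨p, hp⟩) (b := ⟨q, hq⟩) (by simpa using hlt))
          (by simpa using h)
      exact ⟨q, by omega, rfl⟩
    · rintro ⟨r, hr, rfl⟩
      exact ⟨⟨r, by omega, rfl⟩,
        hs.strictMono_get.monotone (a := ⟨r, by omega⟩) (b := ⟨p, hp⟩)
          (by simp only [Fin.mk_le_mk]; omega)⟩
  rw [hm, List.toFinset_card_of_nodup ((S.sort_nodup _).sublist (List.take_sublist _ _)),
    List.length_take]
  omega

namespace ModularLink

variable {L₁ L₂ : ModularLink}

theorem length_eq_of_image_range_map {α β ι ι' : Type*} [Nonempty ι] {s t : List ℕ}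
    {F : ι → ℕ → α} {G : ι' → ℕ → β} {f : α → β}
    (h : List.map f '' range (fun i => s.map (F i)) = range fun i => t.map (G i)) :
    s.length = t.length := by
  obtain ⟨i⟩ := ‹Nonempty ι›
  have hm : (s.map (F i)).map f ∈ range fun i => t.map (G i) := h ▸ mem_image_of_mem _ ⟨i, rfl⟩
  obtain ⟨i', hi⟩ := hm
  simpa using (congrArg List.length hi).symm

instance nonempty_fin_c (L : ModularLink) : Nonempty (Fin L.c) := ⟨⟨0, L.c_pos⟩⟩

/-- If `a` lies in the `p`-th set of its tuple, then `e a` lies in the `p`-th set of the image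
tuple, so its exponent is the `p`-th in the sorted list of the other link. -/
theorem SameBaseOrders.exists_equiv (h : SameBaseOrders L₁ L₂) :
    L₁.xExponents.card = L₂.xExponents.card ∧ L₁.yExponents.card = L₂.yExponents.card ∧
    ∃ e : L₁.Label ≃ L₂.Label, (∀ a, e (L₁.next a) = L₂.next (e a)) ∧
      (∀ a, L₂.xRank (e a) = L₁.xRank a) ∧ ∀ a, L₂.yRank (e a) = L₁.yRank a := by
  obtain ⟨e, he, hx, hy⟩ := h
  have cx : L₁.xExponents.card = L₂.xExponents.card := by
    simpa using length_eq_of_image_range_map hx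
  have cy : L₁.yExponents.card = L₂.yExponents.card := by
    simpa using length_eq_of_image_range_map hy
  refine ⟨cx, cy, e, he, fun a => ?_, fun a => ?_⟩
  · have ha : L₁.xExp a ∈ L₁.xExponents.sort (· ≥ ·) :=
      (Finset.mem_sort _).2 (Finset.mem_image_of_mem _ (Finset.mem_univ a))
    obtain ⟨p, hp, hpa⟩ := List.mem_iff_getElem.1 ha
    obtain ⟨i', hi⟩ : _ ∈ L₂.xBaseOrder := hx ▸ mem_image_of_mem _ (mem_range_self a.1)
    have hp2 : p < (L₂.xExponents.sort (· ≥ ·)).length := by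
      rw [Finset.length_sort] at hp ⊢; omega
    have hg := List.getElem_of_eq hi (i := p) (by simpa using hp2)
    simp only [List.getElem_map] at hg
    have hm : e a ∈ Finset.univ.filter fun b : L₂.Label =>
        b.1 = i' ∧ L₂.xExp b = (L₂.xExponents.sort (· ≥ ·))[p] := by
      rw [hg]
      simp [hpa]
    rw [Finset.mem_filter] at hm
    rw [xRank, xRank, hm.2.2, ← hpa, card_filter_le_sort_getElem, card_filter_le_sort_getElem, cx]
  · have ha : L₁.yExp a ∈ L₁.yExponents.sort (· ≤ ·) :=
      (Finset.mem_sort _).2 (Finset.mem_image_of_mem _ (Finset.mem_univ a))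
    obtain ⟨p, hp, hpa⟩ := List.mem_iff_getElem.1 ha
    obtain ⟨i', hi⟩ : _ ∈ L₂.yBaseOrder := hy ▸ mem_image_of_mem _ (mem_range_self a.1)
    have hp2 : p < (L₂.yExponents.sort (· ≤ ·)).length := by
      rw [Finset.length_sort] at hp ⊢; omega
    have hg := List.getElem_of_eq hi (i := p) (by simpa using hp2)
    simp only [List.getElem_map] at hg
    have hm : e a ∈ Finset.univ.filter fun b : L₂.Label =>
        b.1 = i' ∧ L₂.yExp b = (L₂.yExponents.sort (· ≤ ·))[p] := by
      rw [hg]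
      simp [hpa]
    rw [Finset.mem_filter] at hm
    rw [yRank, yRank, hm.2.2, ← hpa, card_filter_le_sort_le_getElem,
      card_filter_le_sort_le_getElem]

/-! ### Ranks determine the orders within the bunches. -/

variable {L : ModularLink}

theorem xRank_lt_iff {a b : L.Label} :
    L.xRank a < L.xRank b ↔ L.xExp a < L.xExp b := by
  have mono : ∀ {a b}, L.xExp a ≤ L.xExp b → L.xRank a ≤ L.xRank b := fun h =>
    Finset.card_le_card (Finset.monotone_filter_right _ fun _ _ h' => le_trans h' h)
  refine ⟨fun h => not_le.1 fun h' => (mono h').not_gt h, fun h => ?_⟩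
  refine Finset.card_lt_card (Finset.ssubset_iff_of_subset
    (Finset.monotone_filter_right _ fun _ _ h' => le_trans h' h.le) |>.2 ⟨L.xExp b, ?_, ?_⟩)
  · simp [xExponents]
  · simp [h]

theorem yRank_lt_iff {a b : L.Label} :
    L.yRank a < L.yRank b ↔ L.yExp a < L.yExp b := by
  have mono : ∀ {a b}, L.yExp a ≤ L.yExp b → L.yRank a ≤ L.yRank b := fun h =>
    Finset.card_le_card (Finset.monotone_filter_right _ fun _ _ h' => le_trans h' h)
  refine ⟨fun h => not_le.1 fun h' => (mono h').not_gt h, fun h => ?_⟩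
  refine Finset.card_lt_card (Finset.ssubset_iff_of_subset
    (Finset.monotone_filter_right _ fun _ _ h' => le_trans h' h.le) |>.2 ⟨L.yExp b, ?_, ?_⟩)
  · simp [yExponents]
  · simp [h]

theorem xRank_eq_iff {a b : L.Label} :
    L.xRank a = L.xRank b ↔ L.xExp a = L.xExp b := by
  rw [le_antisymm_iff, le_antisymm_iff, ← not_lt, ← not_lt, ← not_lt, ← not_lt, xRank_lt_iff,
    xRank_lt_iff]

theorem yRank_eq_iff {a b : L.Label} :
    L.yRank a = L.yRank b ↔ L.yExp a = L.yExp b := by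
  rw [le_antisymm_iff, le_antisymm_iff, ← not_lt, ← not_lt, ← not_lt, ← not_lt, yRank_lt_iff,
    yRank_lt_iff]

/-- Both links run the same lexicographic comparison, since each decision depends only on ranks. It
stops because every round of ties enlarges the gap, which cannot reach 1. -/
theorem xStart_lt_of_equiv {e : L₁.Label ≃ L₂.Label} (he : ∀ a, e (L₁.next a) = L₂.next (e a))
    (hx : ∀ a, L₂.xRank (e a) = L₁.xRank a) (hy : ∀ a, L₂.yRank (e a) = L₁.yRank a)
    {a b : L₁.Label} (h : L₁.xStart a < L₁.xStart b) : L₂.xStart (e a) < L₂.xStart (e b) := by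
  -- Here `n` bounds the number of remaining rounds: a tie in both exponents multiplies the gap by
  -- at least 4, of which a factor 2 is used.
  have key : ∀ (n : ℕ) (a b : L₁.Label), (1 : ℝ) ≤ 2 ^ n * (L₁.xStart b - L₁.xStart a) →
      L₂.xStart (e a) < L₂.xStart (e b) := by
    intro n
    induction n with
    | zero =>
      intro a b h
      have := L₁.xStart_lt b
      have := L₁.le_xStart a
      linarith
    | succ n ih =>
      intro a b h
      have hpos : L₁.xStart a < L₁.xStart b := by
        by_contra hle
        have : 2 ^ (n + 1) * (L₁.xStart b - L₁.xStart a) ≤ 0 :=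
          mul_nonpos_of_nonneg_of_nonpos (by positivity) (by linarith)
        linarith
      rcases (L₁.yExp_le_of_xStart_le hpos.le).lt_or_eq with hlt | heq
      · refine L₂.xStart_lt_of_yExp_lt (yRank_lt_iff.1 ?_)
        rwa [hy, hy, yRank_lt_iff]
      have hs := L₁.yStart_sub heq
      have h2 := two_le_two_pow (L₁.yExp_pos a)
      have hs' : 2 * (L₁.xStart b - L₁.xStart a) ≤ L₁.yStart b - L₁.yStart a := by
        rw [hs]; exact mul_le_mul_of_nonneg_right h2 (by linarith)
      have heq' : L₂.yExp (e a) = L₂.yExp (e b) := by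
        rw [← yRank_eq_iff, hy, hy, yRank_eq_iff, heq]
      rw [← sub_pos, ← mul_pos_iff_of_pos_left (a := (2 : ℝ) ^ L₂.yExp (e a)) (by positivity),
        ← L₂.yStart_sub heq', sub_pos]
      have hpos' : L₁.yStart a < L₁.yStart b := by linarith
      rcases (L₁.xExp_le_of_yStart_le hpos'.le).lt_or_eq with hlt | hxeq
      · refine L₂.yStart_lt_of_xExp_lt (xRank_lt_iff.1 ?_)
        rwa [← he, ← he, hx, hx, xRank_lt_iff]
      have ht := L₁.xStart_next_sub hxeq.symm
      have h3 := two_le_two_pow (L₁.xExp_pos (L₁.next a))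
      have hxeq' : L₂.xExp (L₂.next (e a)) = L₂.xExp (L₂.next (e b)) := by
        rw [← xRank_eq_iff, ← he, ← he, hx, hx, xRank_eq_iff, hxeq]
      rw [L₂.yStart_lt_iff hxeq', ← he, ← he]
      refine ih _ _ (h.trans ?_)
      rw [pow_succ, mul_assoc, ht]
      refine mul_le_mul_of_nonneg_left ?_ (by positivity)
      nlinarith
  have hd : 0 < L₁.xStart b - L₁.xStart a := sub_pos.2 h
  obtain ⟨n, hn⟩ := pow_unbounded_of_one_lt (1 / (L₁.xStart b - L₁.xStart a)) one_lt_two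
  rw [div_lt_iff₀ hd] at hn
  exact key n a b hn.le

theorem yStart_lt_of_equiv {e : L₁.Label ≃ L₂.Label} (he : ∀ a, e (L₁.next a) = L₂.next (e a))
    (hx : ∀ a, L₂.xRank (e a) = L₁.xRank a) (hy : ∀ a, L₂.yRank (e a) = L₁.yRank a)
    {a b : L₁.Label} (h : L₁.yStart a < L₁.yStart b) : L₂.yStart (e a) < L₂.yStart (e b) := by
  rcases (L₁.xExp_le_of_yStart_le h.le).lt_or_eq with hlt | heq
  · refine L₂.yStart_lt_of_xExp_lt (xRank_lt_iff.1 ?_)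
    rwa [← he, ← he, hx, hx, xRank_lt_iff]
  · have heq' : L₂.xExp (L₂.next (e a)) = L₂.xExp (L₂.next (e b)) := by
      rw [← xRank_eq_iff, ← he, ← he, hx, hx, xRank_eq_iff, heq]
    rw [L₂.yStart_lt_iff heq', ← he, ← he]
    exact xStart_lt_of_equiv he hx hy ((L₁.yStart_lt_iff heq.symm).1 h)

end ModularLink

/-! ### Axis-parallel segments -/

theorem segment_prodMk_left {F : Type*} [AddCommGroup F] [Module ℝ F] (a b : ℝ) (y : F) :
    segment ℝ (a, y) (b, y) = uIcc a b ×ˢ {y} := by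
  rw [← Prod.image_mk_segment_left, segment_eq_uIcc, prod_singleton]

theorem segment_prodMk_right {E : Type*} [AddCommGroup E] [Module ℝ E] (x : E) (a b : ℝ) :
    segment ℝ (x, a) (x, b) = {x} ×ˢ uIcc a b := by
  rw [← Prod.image_mk_segment_right, segment_eq_uIcc, singleton_prod]

/-! ### Existence of parent diagrams -/

theorem exists_equiv_strictMono {α : Type*} [Fintype α] {N : ℕ} (hN : Fintype.card α = N)
    {f : α → ℝ} (hf : Function.Injective f) : ∃ σ : Fin N ≃ α, StrictMono fun r => f (σ r) := by
  let _ : LinearOrder α := LinearOrder.lift' f hf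
  let σ := Fintype.orderIsoFinOfCardEq α hN
  exact ⟨σ.toEquiv, fun _ _ h => σ.strictMono h⟩

namespace ModularLink

variable (L : ModularLink)

theorem card_label : Fintype.card L.Label = L.nbar := by
  simp [Label, nbar]

variable {L}

theorem mem_xArc {hx hy cx cy : L.Label → ℝ} {a : L.Label} (hc : cx a ≤ cy a) (hh : hx a ≤ hy a)
    {p : ℝ × ℝ} : p ∈ L.xArc hx hy cx cy a ↔
      (p.1 ∈ Icc (cx a) (cy a) ∧ p.2 = hx a) ∨ (p.1 = cy a ∧ p.2 ∈ Icc (hx a) (hy a)) := by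
  rw [xArc, segment_prodMk_left, segment_prodMk_right, uIcc_of_le hc, uIcc_of_le hh]
  rfl

theorem mem_yArc {hx hy cx cy : L.Label → ℝ} {a : L.Label} (hc : cx (L.next a) ≤ cy a)
    (hh : hx (L.next a) ≤ hy a) {p : ℝ × ℝ} : p ∈ L.yArc hx hy cx cy a ↔
      (p.1 ∈ Icc (cx (L.next a)) (cy a) ∧ p.2 = hy a) ∨
        (p.1 = cx (L.next a) ∧ p.2 ∈ Icc (hx (L.next a)) (hy a)) := by
  rw [yArc, segment_prodMk_left, segment_prodMk_right, uIcc_of_ge hc, uIcc_of_ge hh]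
  rfl

/-- The arcs are nested: `b` starts higher and turns upwards before reaching the column of `a`. -/
theorem disjoint_xArc {hx hy cx cy : L.Label → ℝ} {a b : L.Label} (hca : cx a < 0)
    (hcb : cx b < 0) (hyb : 0 < cy b) (hha : hx a < hy a) (hhb : hx b < hy b)
    (h1 : hx a < hx b) (h2 : cy b < cy a) :
    Disjoint (L.xArc hx hy cx cy a) (L.xArc hx hy cx cy b) := by
  rw [Set.disjoint_left]
  intro p ha hb
  rw [mem_xArc (by linarith) hha.le] at ha
  rw [mem_xArc (by linarith) hhb.le] at hb
  rcases ha with ⟨⟨_, _⟩, _⟩ | ⟨_, _, _⟩ <;> rcases hb with ⟨⟨_, _⟩, _⟩ | ⟨_, _, _⟩ <;> linarith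

theorem disjoint_yArc {hx hy cx cy : L.Label → ℝ} {a b : L.Label} (hya : 0 < cy a)
    (hcb : cx (L.next b) < 0) (hyb : 0 < cy b) (hha : hx (L.next a) < hy a)
    (hhb : hx (L.next b) < hy b) (h1 : hy b < hy a) (h2 : cx (L.next a) < cx (L.next b)) :
    Disjoint (L.yArc hx hy cx cy a) (L.yArc hx hy cx cy b) := by
  rw [Set.disjoint_left]
  intro p ha hb
  rw [mem_yArc (by linarith) hha.le] at ha
  rw [mem_yArc (by linarith) hhb.le] at hb
  rcases ha with ⟨⟨_, _⟩, _⟩ | ⟨_, _, _⟩ <;> rcases hb with ⟨⟨_, _⟩, _⟩ | ⟨_, _, _⟩ <;> linarith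

variable (L)

theorem exists_parentDiagram : Nonempty L.ParentDiagram := by
  obtain ⟨σ, hσ⟩ := exists_equiv_strictMono L.card_label L.xStart_injective
  obtain ⟨τ, hτ⟩ := exists_equiv_strictMono L.card_label L.yStart_injective
  -- Equally spaced points of `(0, 1)`, used as offsets inside the unit gaps for all heights and
  -- columns.
  let w : Fin L.nbar → ℝ := fun r => ((r : ℕ) + 1) / ((L.nbar : ℝ) + 1)
  have hw : StrictMono w := fun r s h => by
    have : ((r : ℕ) : ℝ) < (s : ℕ) := Nat.cast_lt.2 h
    simp only [w]
    gcongr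
  have w0 : ∀ r, 0 < w r := fun r => by positivity
  have w1 : ∀ r, w r < 1 := fun r => by
    have : ((r : ℕ) : ℝ) < L.nbar := Nat.cast_lt.2 r.2
    rw [div_lt_one (by positivity)]
    linarith
  have hσ' : ∀ {a b}, L.xStart a < L.xStart b → w (σ.symm a) < w (σ.symm b) := fun {a b} h =>
    hw (hσ.lt_iff_lt.1 (by simpa using h))
  have hτ' : ∀ {a b}, L.yStart a < L.yStart b → w (τ.symm a) < w (τ.symm b) := fun {a b} h =>
    hw (hτ.lt_iff_lt.1 (by simpa using h))
  let hx : L.Label → ℝ := fun a => -2 + w (σ.symm a)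
  let hy : L.Label → ℝ := fun a => 2 - w (τ.symm a)
  let cx : L.Label → ℝ := fun a => -((L.xRank a : ℝ) + 1) + w (σ.symm a)
  let cy : L.Label → ℝ := fun a => (L.yRank a : ℝ) + 1 - w (σ.symm a)
  have hcx : ∀ a, cx a < 0 := fun a => by
    have := w1 (σ.symm a)
    have := (Nat.cast_nonneg (L.xRank a) : (0 : ℝ) ≤ _)
    simp only [cx]; linarith
  have hcy : ∀ a, 0 < cy a := fun a => by
    have := w1 (σ.symm a)
    have := (Nat.cast_nonneg (L.yRank a) : (0 : ℝ) ≤ _)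
    simp only [cy]; linarith
  have hxy : ∀ a b, hx a < hy b := fun a b => by
    have := w1 (σ.symm a)
    have := w1 (τ.symm b)
    simp only [hx, hy]; linarith
  have xd : ∀ a b, L.yExp a = L.yExp b → L.xStart a < L.xStart b →
      Disjoint (L.xArc hx hy cx cy a) (L.xArc hx hy cx cy b) := fun a b he h => by
    have := hσ' h
    refine disjoint_xArc (hcx _) (hcx _) (hcy _) (hxy _ _) (hxy _ _) ?_ ?_
    · simp only [hx]; linarith
    · simp only [cy, yRank_eq_iff.2 he]; linarith
  have yd : ∀ a b, L.xExp (L.next a) = L.xExp (L.next b) → L.yStart a < L.yStart b →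
      Disjoint (L.yArc hx hy cx cy a) (L.yArc hx hy cx cy b) := fun a b he h => by
    have := hτ' h
    -- For equal following `x`-exponents, the `y`-order of two labels is the `x`-order of their
    -- successors, so offsets by `σ` also suit the left columns.
    have := hσ' ((L.yStart_lt_iff he).1 h)
    refine disjoint_yArc (hcy _) (hcx _) (hcy _) (hxy _ _) (hxy _ _) ?_ ?_
    · simp only [hy]; linarith
    · simp only [cx, xRank_eq_iff.2 he]; linarith
  exact ⟨{
    σ := σ, σ_order := hσ, τ := τ, τ_order := hτ, hx := hx, hy := hy, cx := cx, cy := cy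
    hx_order := fun r s h => by simpa [hx] using hw h
    hy_order := fun r s h => by simpa [hy] using hw h
    hx_mem := fun a => by
      have := w0 (σ.symm a); have := w1 (σ.symm a)
      constructor <;> simp only [hx] <;> linarith
    hy_mem := fun a => by
      have := w0 (τ.symm a); have := w1 (τ.symm a)
      constructor <;> simp only [hy] <;> linarith
    cx_mem := fun a => by
      have := w0 (σ.symm a); have := w1 (σ.symm a)
      constructor <;> simp only [cx] <;> linarith
    cy_mem := fun a => by
      have := w0 (σ.symm a); have := w1 (σ.symm a)
      constructor <;> simp only [cy] <;> linarith
    x_disjoint := fun a b hab he => by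
      rcases (L.xStart_injective.ne hab).lt_or_gt with h | h
      · exact xd a b he h
      · exact (xd b a he.symm h).symm
    y_disjoint := fun a b hab he => by
      rcases (L.yStart_injective.ne hab).lt_or_gt with h | h
      · exact yd a b he h
      · exact (yd b a he.symm h).symm }⟩

/-! ### Rigidity of parent diagrams. -/

namespace ParentDiagram

variable {L} (D : L.ParentDiagram)

theorem cx_neg (a : L.Label) : D.cx a < 0 := by
  have := (D.cx_mem a).2
  have := (Nat.cast_nonneg (L.xRank a) : (0 : ℝ) ≤ _)
  linarith

theorem cy_pos (a : L.Label) : 0 < D.cy a := by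
  have := (D.cy_mem a).1
  have := (Nat.cast_nonneg (L.yRank a) : (0 : ℝ) ≤ _)
  linarith

theorem hx_lt_hy (a b : L.Label) : D.hx a < D.hy b := by
  have := (D.hx_mem a).2
  have := (D.hy_mem b).1
  linarith

theorem hx_lt_iff {a b : L.Label} : D.hx a < D.hx b ↔ L.xStart a < L.xStart b := by
  have h1 := D.hx_order.lt_iff_lt (a := D.σ.symm a) (b := D.σ.symm b)
  have h2 := D.σ_order.lt_iff_lt (a := D.σ.symm a) (b := D.σ.symm b)
  simp only [Equiv.apply_symm_apply] at h1 h2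
  rw [h1, h2]

theorem hy_lt_iff {a b : L.Label} : D.hy b < D.hy a ↔ L.yStart a < L.yStart b := by
  have h1 := D.hy_order.lt_iff_gt (a := D.τ.symm b) (b := D.τ.symm a)
  have h2 := D.τ_order.lt_iff_lt (a := D.τ.symm a) (b := D.τ.symm b)
  simp only [Equiv.apply_symm_apply] at h1 h2
  rw [h1, h2]

/-- Otherwise the vertical part of the arc of `a` would hit the horizontal part of the arc of `b` at
`(cy a, hx b)`. -/
theorem cy_lt {a b : L.Label} (he : L.yExp a = L.yExp b) (h : L.xStart a < L.xStart b) :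
    D.cy b < D.cy a := by
  by_contra! hle
  refine Set.disjoint_left.1 (D.x_disjoint a b (by rintro rfl; exact h.false) he)
    (?_ : (D.cy a, D.hx b) ∈ _) ?_
  · rw [mem_xArc ((D.cx_neg a).trans (D.cy_pos a)).le (D.hx_lt_hy a a).le]
    exact Or.inr ⟨rfl, (D.hx_lt_iff.2 h).le, (D.hx_lt_hy b a).le⟩
  · rw [mem_xArc ((D.cx_neg b).trans (D.cy_pos b)).le (D.hx_lt_hy b b).le]
    exact Or.inl ⟨⟨((D.cx_neg b).trans (D.cy_pos a)).le, hle⟩, rfl⟩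

theorem cx_lt {a b : L.Label} (he : L.xExp a = L.xExp b) (h : L.xStart a < L.xStart b) :
    D.cx a < D.cx b := by
  obtain ⟨a, rfl⟩ := L.next_surjective a
  obtain ⟨b, rfl⟩ := L.next_surjective b
  rw [← L.yStart_lt_iff he] at h
  by_contra! hle
  refine Set.disjoint_left.1 (D.y_disjoint a b (by rintro rfl; exact h.false) he)
    (?_ : (D.cx (L.next a), D.hy b) ∈ _) ?_
  · rw [mem_yArc ((D.cx_neg _).trans (D.cy_pos a)).le (D.hx_lt_hy _ a).le]
    exact Or.inr ⟨rfl, (D.hx_lt_hy _ b).le, (D.hy_lt_iff.2 h).le⟩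
  · rw [mem_yArc ((D.cx_neg _).trans (D.cy_pos b)).le (D.hx_lt_hy _ b).le]
    exact Or.inl ⟨⟨hle, ((D.cx_neg _).trans (D.cy_pos b)).le⟩, rfl⟩

end ParentDiagram

end ModularLink

/-! ### Extension of finite order-preserving maps of the line -/

/-- Stretch the half-line to the right of `z` by the factor `(v - z) / (u - z)`; the inverse
stretches by the reciprocal. -/
theorem exists_orderIso_fixing_Iic {z u v : ℝ} (hu : z < u) (hv : z < v) :
    ∃ h : ℝ ≃o ℝ, (∀ x ≤ z, h x = x) ∧ h u = v := by
  have key : ∀ {c d : ℝ}, 0 < c → c * d = 1 → ∀ x,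
      (x + (c - 1) * max (x - z) 0) + (d - 1) * max (x + (c - 1) * max (x - z) 0 - z) 0 = x := by
    intro c d hc hcd x
    rcases le_total x z with h | h
    · rw [max_eq_right (sub_nonpos.2 h), mul_zero, add_zero, max_eq_right (sub_nonpos.2 h)]
      ring
    · rw [max_eq_left (sub_nonneg.2 h), show x + (c - 1) * (x - z) - z = c * (x - z) by ring,
        max_eq_left (mul_nonneg hc.le (sub_nonneg.2 h))]
      linear_combination (x - z) * hcd
  have mono : ∀ {c : ℝ}, 0 < c → Monotone fun x => x + (c - 1) * max (x - z) 0 := by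
    intro c hc x y hxy
    simp only
    rcases le_total x z with h | h <;> rcases le_total y z with h' | h'
    · simp [h, h', hxy]
    · rw [max_eq_right (sub_nonpos.2 h), max_eq_left (sub_nonneg.2 h')]
      nlinarith [mul_nonneg hc.le (sub_nonneg.2 h')]
    · rw [max_eq_right (sub_nonpos.2 h'), max_eq_left (sub_nonneg.2 h)]
      have : x = y := by linarith
      have : x = z := by linarith
      subst this; simp_all
    · rw [max_eq_left (sub_nonneg.2 h'), max_eq_left (sub_nonneg.2 h)]
      nlinarith [mul_le_mul_of_nonneg_left hxy hc.le]
  have hu' : 0 < u - z := sub_pos.2 hu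
  have hv' : 0 < v - z := sub_pos.2 hv
  have h1 : (v - z) / (u - z) * ((u - z) / (v - z)) = 1 := by field_simp
  have c1 : 0 < (v - z) / (u - z) := by positivity
  have c2 : 0 < (u - z) / (v - z) := by positivity
  refine ⟨Equiv.toOrderIso ⟨fun x => x + ((v - z) / (u - z) - 1) * max (x - z) 0,
    fun x => x + ((u - z) / (v - z) - 1) * max (x - z) 0, key c1 h1,
    key c2 ((mul_comm _ _).trans h1)⟩ (mono c1) (mono c2), fun x hx => ?_, ?_⟩
  · simp [max_eq_right (sub_nonpos.2 hx)]
  · simp only [Equiv.coe_toOrderIso, Equiv.coe_fn_mk, max_eq_left hu'.le]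
    field_simp
    ring

/-- Points are added in order of increasing `f`. A new maximum is put in place by a stretch to the
right of the previous maximal value, which leaves the earlier points alone. -/
theorem exists_orderIso_extending {ι : Type*} [Finite ι] {f g : ι → ℝ}
    (h : ∀ i j, f i < f j → g i < g j) (h' : ∀ i j, f i = f j → g i = g j) :
    ∃ ψ : ℝ ≃o ℝ, ∀ i, ψ (f i) = g i := by
  classical
  have := Fintype.ofFinite ι
  suffices H : ∀ s : Finset ι, ∃ ψ : ℝ ≃o ℝ, ∀ i ∈ s, ψ (f i) = g i by
    obtain ⟨ψ, hψ⟩ := H Finset.univ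
    exact ⟨ψ, fun i => hψ i (Finset.mem_univ i)⟩
  intro s
  induction s using Finset.induction_on_max_value f with
  | empty => exact ⟨OrderIso.refl ℝ, by simp⟩
  | insert a s ha hmax ih =>
    obtain ⟨ψ, hψ⟩ := ih
    rcases s.eq_empty_or_nonempty with rfl | hs
    · exact ⟨OrderIso.addRight (g a - f a), by simp⟩
    obtain ⟨m, hm, hmm⟩ := s.exists_max_image f hs
    rcases (hmax m hm).eq_or_lt with he | hlt
    · refine ⟨ψ, fun i hi => ?_⟩
      rcases Finset.mem_insert.1 hi with rfl | hi
      · rw [← he, hψ m hm, h' _ _ he]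
      · exact hψ i hi
    · obtain ⟨k, hk, hka⟩ := exists_orderIso_fixing_Iic (z := g m) (u := ψ (f a)) (v := g a)
        (by rw [← hψ m hm]; exact ψ.strictMono hlt) (h _ _ hlt)
      refine ⟨ψ.trans k, fun i hi => ?_⟩
      rcases Finset.mem_insert.1 hi with rfl | hi
      · exact hka
      · rw [OrderIso.trans_apply, hψ i hi, hk]
        rw [← hψ i hi, ← hψ m hm]
        exact ψ.monotone (hmm i hi)

/-- Order-preserving maps within the gaps between consecutive integers extend to an order
isomorphism of the line that fixes a given finite set of integers. -/
theorem exists_orderIso_fixing_integers {ι : Type*} [Finite ι] {f g : ι → ℝ} (z : ι → ℤ)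
    (hf : ∀ i, f i ∈ Ioo (z i : ℝ) (z i + 1)) (hg : ∀ i, g i ∈ Ioo (z i : ℝ) (z i + 1))
    (h : ∀ i j, z i = z j → f i < f j → g i < g j)
    (h' : ∀ i j, z i = z j → f i = f j → g i = g j) (S : Finset ℤ) :
    ∃ ψ : ℝ ≃o ℝ, (∀ i, ψ (f i) = g i) ∧ ∀ n ∈ S, ψ n = n := by
  have floor_f : ∀ i, ⌊f i⌋ = z i := fun i => Int.floor_eq_iff.2 ⟨(hf i).1.le, (hf i).2⟩
  have int_lt : ∀ {n : ℤ} {i}, (n : ℝ) < f i → (n : ℝ) < g i := fun {n i} hn => by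
    have : n ≤ z i := floor_f i ▸ Int.le_floor.2 hn.le
    exact lt_of_le_of_lt (Int.cast_le.2 this) (hg i).1
  have lt_int : ∀ {n : ℤ} {i}, f i < (n : ℝ) → g i < (n : ℝ) := fun {n i} hn => by
    have : z i < n := floor_f i ▸ Int.floor_lt.2 hn
    exact lt_of_lt_of_le (hg i).2 (by exact_mod_cast this)
  have ne_int : ∀ {n : ℤ} {i}, f i ≠ n := fun {n i} hn => by
    have h1 : n = z i := by rw [← floor_f i, hn, Int.floor_intCast]
    exact (hf i).1.ne' (by rw [hn, h1])
  -- The integers to be fixed join the data as extra points mapped to themselves.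
  obtain ⟨ψ, hψ⟩ := exists_orderIso_extending (ι := ι ⊕ S)
    (f := Sum.elim f fun n => ((n : ℤ) : ℝ)) (g := Sum.elim g fun n => ((n : ℤ) : ℝ)) (by
      rintro (i | n) (j | m) hij
      · simp only [Sum.elim_inl] at hij ⊢
        rcases (show z i ≤ z j from floor_f i ▸ floor_f j ▸ Int.floor_mono hij.le).lt_or_eq with
          hz | hz
        · have : ((z i : ℝ) + 1) ≤ z j := by exact_mod_cast hz
          linarith [(hg i).2, (hg j).1]
        · exact h i j hz hij
      · exact lt_int hij
      · exact int_lt hij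
      · exact hij) (by
      rintro (i | n) (j | m) hij
      · simp only [Sum.elim_inl] at hij ⊢
        exact h' i j (by rw [← floor_f, ← floor_f, hij]) hij
      · exact absurd hij ne_int
      · exact absurd hij.symm ne_int
      · exact hij)
  exact ⟨ψ, fun i => hψ (Sum.inl i), fun n hn => hψ (Sum.inr ⟨n, hn⟩)⟩

/-! ### Matching the diagrams of two links. -/

namespace ModularLink

variable {L₁ L₂ : ModularLink}

theorem exists_orderIso_columns {e : L₁.Label ≃ L₂.Label}
    (he : ∀ a, e (L₁.next a) = L₂.next (e a))
    (hx : ∀ a, L₂.xRank (e a) = L₁.xRank a) (hy : ∀ a, L₂.yRank (e a) = L₁.yRank a)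
    (D₁ : L₁.ParentDiagram) (D₂ : L₂.ParentDiagram) (S : Finset ℤ) :
    ∃ ψ : ℝ ≃o ℝ, (∀ a, ψ (D₁.cx a) = D₂.cx (e a)) ∧ (∀ a, ψ (D₁.cy a) = D₂.cy (e a)) ∧
      ∀ n ∈ S, ψ n = n := by
  have hx' : ∀ {a b}, L₁.xExp a = L₁.xExp b → L₂.xExp (e a) = L₂.xExp (e b) := fun h => by
    rw [← xRank_eq_iff, hx, hx, xRank_eq_iff, h]
  have hy' : ∀ {a b}, L₁.yExp a = L₁.yExp b → L₂.yExp (e a) = L₂.yExp (e b) := fun h => by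
    rw [← yRank_eq_iff, hy, hy, yRank_eq_iff, h]
  have X : ∀ {a b}, L₁.xExp a = L₁.xExp b → D₁.cx a < D₁.cx b → L₁.xStart a < L₁.xStart b := by
    intro a b hab h
    by_contra! hle
    rcases hle.lt_or_eq with hlt | heq
    · exact (D₁.cx_lt hab.symm hlt).not_gt h
    · rw [L₁.xStart_injective heq] at h; exact h.false
  have Y : ∀ {a b}, L₁.yExp a = L₁.yExp b → D₁.cy a < D₁.cy b → L₁.xStart b < L₁.xStart a := by
    intro a b hab h
    by_contra! hle
    rcases hle.lt_or_eq with hlt | heq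
    · exact (D₁.cy_lt hab hlt).not_gt h
    · rw [L₁.xStart_injective heq] at h; exact h.false
  have X' : ∀ {a b}, L₁.xExp a = L₁.xExp b → D₁.cx a = D₁.cx b → a = b := by
    intro a b hab h
    by_contra hne
    rcases (L₁.xStart_injective.ne hne).lt_or_gt with hlt | hlt
    · exact (D₁.cx_lt hab hlt).ne h
    · exact (D₁.cx_lt hab.symm hlt).ne' h
  have Y' : ∀ {a b}, L₁.yExp a = L₁.yExp b → D₁.cy a = D₁.cy b → a = b := by
    intro a b hab h
    by_contra hne
    rcases (L₁.xStart_injective.ne hne).lt_or_gt with hlt | hlt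
    · exact (D₁.cy_lt hab hlt).ne' h
    · exact (D₁.cy_lt hab.symm hlt).ne h
  obtain ⟨ψ, h1, h2⟩ := exists_orderIso_fixing_integers (ι := L₁.Label ⊕ L₁.Label)
    (f := Sum.elim D₁.cx D₁.cy) (g := Sum.elim (fun a => D₂.cx (e a)) fun a => D₂.cy (e a))
    -- The integer parts of the columns. They are negative on the left and nonnegative on the right,
    -- so left and right columns never share a gap.
    (Sum.elim (fun a => -((L₁.xRank a : ℤ) + 1)) fun a => (L₁.yRank a : ℤ))
    (by
      rintro (a | a)
      · have := D₁.cx_mem a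
        simpa using this
      · have := D₁.cy_mem a
        simpa using this)
    (by
      rintro (a | a)
      · have := D₂.cx_mem (e a)
        rw [hx] at this
        simpa using this
      · have := D₂.cy_mem (e a)
        rw [hy] at this
        simpa using this)
    (by
      rintro (a | a) (b | b) hz h
      · have hz : L₁.xRank a = L₁.xRank b := by simpa using hz
        rw [xRank_eq_iff] at hz
        exact D₂.cx_lt (hx' hz) (xStart_lt_of_equiv he hx hy (X hz h))
      · simp only [Sum.elim_inl, Sum.elim_inr] at hz; omega
      · simp only [Sum.elim_inl, Sum.elim_inr] at hz; omega
      · have hz : L₁.yRank a = L₁.yRank b := by simpa using hz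
        rw [yRank_eq_iff] at hz
        exact D₂.cy_lt (hy' hz.symm) (xStart_lt_of_equiv he hx hy (Y hz h)))
    (by
      rintro (a | a) (b | b) hz h
      · have hz : L₁.xRank a = L₁.xRank b := by simpa using hz
        rw [xRank_eq_iff] at hz
        rw [X' hz h]
      · simp only [Sum.elim_inl, Sum.elim_inr] at hz; omega
      · simp only [Sum.elim_inl, Sum.elim_inr] at hz; omega
      · have hz : L₁.yRank a = L₁.yRank b := by simpa using hz
        rw [yRank_eq_iff] at hz
        rw [Y' hz h]) S
  exact ⟨ψ, fun a => h1 (Sum.inl a), fun a => h1 (Sum.inr a), h2⟩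

theorem exists_orderIso_heights {e : L₁.Label ≃ L₂.Label}
    (he : ∀ a, e (L₁.next a) = L₂.next (e a))
    (hx : ∀ a, L₂.xRank (e a) = L₁.xRank a) (hy : ∀ a, L₂.yRank (e a) = L₁.yRank a)
    (D₁ : L₁.ParentDiagram) (D₂ : L₂.ParentDiagram) (S : Finset ℤ) :
    ∃ φ : ℝ ≃o ℝ, (∀ a, φ (D₁.hx a) = D₂.hx (e a)) ∧ (∀ a, φ (D₁.hy a) = D₂.hy (e a)) ∧
      ∀ n ∈ S, φ n = n := by
  have X : ∀ {a b}, D₁.hx a = D₁.hx b → a = b := by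
    intro a b h
    by_contra hne
    rcases (L₁.xStart_injective.ne hne).lt_or_gt with hlt | hlt
    · exact (D₁.hx_lt_iff.2 hlt).ne h
    · exact (D₁.hx_lt_iff.2 hlt).ne' h
  have Y : ∀ {a b}, D₁.hy a = D₁.hy b → a = b := by
    intro a b h
    by_contra hne
    rcases (L₁.yStart_injective.ne hne).lt_or_gt with hlt | hlt
    · exact (D₁.hy_lt_iff.2 hlt).ne' h
    · exact (D₁.hy_lt_iff.2 hlt).ne h
  obtain ⟨φ, h1, h2⟩ := exists_orderIso_fixing_integers (ι := L₁.Label ⊕ L₁.Label)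
    (f := Sum.elim D₁.hx D₁.hy) (g := Sum.elim (fun a => D₂.hx (e a)) fun a => D₂.hy (e a))
    (Sum.elim (fun _ => -2) fun _ => 1)
    (by
      rintro (a | a)
      · have := D₁.hx_mem a
        norm_num at this ⊢
        exact this
      · have := D₁.hy_mem a
        norm_num at this ⊢
        exact this)
    (by
      rintro (a | a)
      · have := D₂.hx_mem (e a)
        norm_num at this ⊢
        exact this
      · have := D₂.hy_mem (e a)
        norm_num at this ⊢
        exact this)
    (by
      rintro (a | a) (b | b) hz h
      · exact D₂.hx_lt_iff.2 (xStart_lt_of_equiv he hx hy (D₁.hx_lt_iff.1 h))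
      · simp at hz
      · simp at hz
      · exact D₂.hy_lt_iff.2 (yStart_lt_of_equiv he hx hy (D₁.hy_lt_iff.1 h)))
    (by
      rintro (a | a) (b | b) hz h
      · rw [X h]
      · simp at hz
      · simp at hz
      · rw [Y h]) S
  exact ⟨φ, fun a => h1 (Sum.inl a), fun a => h1 (Sum.inr a), h2⟩

end ModularLink

/-! ### Coordinates on the complement of the unknot -/

theorem norm_sqrt_ofReal (a b : ℝ) :
    ‖((Real.sqrt (1 + a ^ 2 + b ^ 2) : ℝ) : ℂ)‖ = Real.sqrt (1 + a ^ 2 + b ^ 2) := by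
  rw [Complex.norm_real, Real.norm_eq_abs, abs_of_nonneg (Real.sqrt_nonneg _)]

theorem sqrt_pos_of_coords (a b : ℝ) : 0 < Real.sqrt (1 + a ^ 2 + b ^ 2) :=
  Real.sqrt_pos.2 (by positivity)

/-- The coordinate from left to right. -/
def planeX (p : S3) : ℝ := (p.1 1).re / ‖p.1 0‖

/-- The coordinate from front to back. -/
def planeY (p : S3) : ℝ := (p.1 1).im / ‖p.1 0‖

/-- A representative of the angle. -/
def angle (p : S3) : ℝ := Complex.arg (p.1 0)

theorem place_zero (a b θ : ℝ) : (place (a, b, θ)).1 0 =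
    Complex.exp (θ * Complex.I) / (Real.sqrt (1 + a ^ 2 + b ^ 2) : ℂ) := rfl

theorem place_one (a b θ : ℝ) : (place (a, b, θ)).1 1 =
    (a + b * Complex.I) / (Real.sqrt (1 + a ^ 2 + b ^ 2) : ℂ) := rfl

theorem norm_place_zero (a b θ : ℝ) :
    ‖(place (a, b, θ)).1 0‖ = (Real.sqrt (1 + a ^ 2 + b ^ 2))⁻¹ := by
  rw [place_zero, norm_div, Complex.norm_exp_ofReal_mul_I, norm_sqrt_ofReal, one_div]

theorem place_notMem_unknotU (q : ℝ × ℝ × ℝ) : place q ∉ unknotU := by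
  obtain ⟨a, b, θ⟩ := q
  intro h
  have h1 : ‖(place (a, b, θ)).1 0‖ = 0 := norm_eq_zero.2 h
  rw [norm_place_zero] at h1
  exact (inv_pos.2 (sqrt_pos_of_coords a b)).ne' h1

@[simp]
theorem planeX_place (a b θ : ℝ) : planeX (place (a, b, θ)) = a := by
  rw [planeX, norm_place_zero, place_one, Complex.div_ofReal_re]
  have := (sqrt_pos_of_coords a b).ne'
  simp only [Complex.add_re, Complex.ofReal_re, Complex.mul_re, Complex.I_re, Complex.I_im,
    Complex.ofReal_im]
  field_simp
  ring

@[simp]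
theorem planeY_place (a b θ : ℝ) : planeY (place (a, b, θ)) = b := by
  rw [planeY, norm_place_zero, place_one, Complex.div_ofReal_im]
  have := (sqrt_pos_of_coords a b).ne'
  simp only [Complex.add_im, Complex.ofReal_re, Complex.mul_im, Complex.I_re, Complex.I_im,
    Complex.ofReal_im]
  field_simp
  ring

theorem cos_angle_place (a b θ : ℝ) : Real.cos (angle (place (a, b, θ))) = Real.cos θ := by
  have h0 : (place (a, b, θ)).1 0 ≠ 0 := place_notMem_unknotU _
  rw [angle, Complex.cos_arg h0, norm_place_zero, place_zero, Complex.div_ofReal_re,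
    Complex.exp_ofReal_mul_I_re]
  have := (sqrt_pos_of_coords a b).ne'
  field_simp

theorem sin_angle_place (a b θ : ℝ) : Real.sin (angle (place (a, b, θ))) = Real.sin θ := by
  rw [angle, Complex.sin_arg, norm_place_zero, place_zero, Complex.div_ofReal_im,
    Complex.exp_ofReal_mul_I_im]
  have := (sqrt_pos_of_coords a b).ne'
  field_simp

theorem exp_mul_I_eq (θ : ℝ) :
    Complex.exp (θ * Complex.I) = (Real.cos θ : ℂ) + (Real.sin θ : ℂ) * Complex.I := by
  rw [Complex.exp_mul_I, Complex.ofReal_cos, Complex.ofReal_sin]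

theorem place_congr {a b θ θ' : ℝ} (hc : Real.cos θ = Real.cos θ') (hs : Real.sin θ = Real.sin θ') :
    place (a, b, θ) = place (a, b, θ') := by
  apply Subtype.ext
  simp only [place, placeVec, exp_mul_I_eq, hc, hs]

/-- The sphere equation turns `√(1 + a² + b²)` into the inverse of the modulus of the first
coordinate. -/
theorem place_coords {p : S3} (hp : p ∉ unknotU) : place (planeX p, planeY p, angle p) = p := by
  have h0 : p.1 0 ≠ 0 := hp
  have hr : 0 < ‖p.1 0‖ := norm_pos_iff.2 h0
  have hn : ‖p.1 0‖ ^ 2 + ‖p.1 1‖ ^ 2 = 1 := by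
    have h := p.2
    rw [mem_sphere_zero_iff_norm, EuclideanSpace.norm_eq, Fin.sum_univ_two] at h
    rwa [Real.sqrt_eq_one] at h
  have hs : Real.sqrt (1 + planeX p ^ 2 + planeY p ^ 2) = ‖p.1 0‖⁻¹ := by
    rw [Real.sqrt_eq_iff_mul_self_eq_of_pos (inv_pos.2 hr), planeX, planeY]
    have h2 : ‖p.1 1‖ ^ 2 = (p.1 1).re ^ 2 + (p.1 1).im ^ 2 := by
      rw [Complex.sq_norm, Complex.normSq_apply]; ring
    rw [h2] at hn
    field_simp
    linarith
  have hr' : ((‖p.1 0‖ : ℝ) : ℂ) ≠ 0 := Complex.ofReal_ne_zero.2 hr.ne'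
  apply Subtype.ext
  ext i
  fin_cases i
  · change (place (planeX p, planeY p, angle p)).1 0 = p.1 0
    rw [place_zero, hs, Complex.ofReal_inv, div_inv_eq_mul, mul_comm]
    exact Complex.norm_mul_exp_arg_mul_I _
  · change (place (planeX p, planeY p, angle p)).1 1 = p.1 1
    rw [place_one, hs, Complex.ofReal_inv, div_inv_eq_mul]
    apply Complex.ext
    · simp [planeX]
      field_simp
    · simp [planeY]
      field_simp

/-- Continuity is asked of cosine and sine only, because `angle` itself jumps at the branch cut of
the argument. -/
theorem continuous_place {X : Type*} [TopologicalSpace X] {a b θ : X → ℝ} (ha : Continuous a)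
    (hb : Continuous b) (hc : Continuous fun x => Real.cos (θ x))
    (hs : Continuous fun x => Real.sin (θ x)) : Continuous fun x => place (a x, b x, θ x) := by
  refine Continuous.subtype_mk ?_ _
  refine (PiLp.continuous_toLp 2 _).comp (continuous_pi fun i => ?_)
  have hd : Continuous fun x => ((Real.sqrt (1 + a x ^ 2 + b x ^ 2) : ℝ) : ℂ) := by fun_prop
  have hd0 : ∀ x, ((Real.sqrt (1 + a x ^ 2 + b x ^ 2) : ℝ) : ℂ) ≠ 0 := fun x =>
    Complex.ofReal_ne_zero.2 (sqrt_pos_of_coords _ _).ne'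
  fin_cases i
  · refine Continuous.div ?_ hd hd0
    simp only [exp_mul_I_eq]
    fun_prop
  · refine Continuous.div ?_ hd hd0
    fun_prop

theorem continuous_coord {X : Type*} [TopologicalSpace X] {p : X → S3} (hp : Continuous p)
    (i : Fin 2) : Continuous fun x => (p x).1 i :=
  (EuclideanSpace.proj (𝕜 := ℂ) i).continuous.comp (continuous_subtype_val.comp hp)

theorem continuous_planeX {X : Type*} [TopologicalSpace X] {p : X → S3} (hp : Continuous p)
    (h0 : ∀ x, p x ∉ unknotU) : Continuous fun x => planeX (p x) :=
  (Complex.continuous_re.comp (continuous_coord hp 1)).div (continuous_coord hp 0).norm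
    fun x => norm_ne_zero_iff.2 (h0 x)

theorem continuous_planeY {X : Type*} [TopologicalSpace X] {p : X → S3} (hp : Continuous p)
    (h0 : ∀ x, p x ∉ unknotU) : Continuous fun x => planeY (p x) :=
  (Complex.continuous_im.comp (continuous_coord hp 1)).div (continuous_coord hp 0).norm
    fun x => norm_ne_zero_iff.2 (h0 x)

theorem continuous_cos_angle {X : Type*} [TopologicalSpace X] {p : X → S3} (hp : Continuous p)
    (h0 : ∀ x, p x ∉ unknotU) : Continuous fun x => Real.cos (angle (p x)) := by
  have : (fun x => Real.cos (angle (p x))) = fun x => ((p x).1 0).re / ‖(p x).1 0‖ :=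
    funext fun x => Complex.cos_arg (h0 x)
  rw [this]
  exact (Complex.continuous_re.comp (continuous_coord hp 0)).div (continuous_coord hp 0).norm
    fun x => norm_ne_zero_iff.2 (h0 x)

theorem continuous_sin_angle {X : Type*} [TopologicalSpace X] {p : X → S3} (hp : Continuous p)
    (h0 : ∀ x, p x ∉ unknotU) : Continuous fun x => Real.sin (angle (p x)) := by
  have : (fun x => Real.sin (angle (p x))) = fun x => ((p x).1 0).im / ‖(p x).1 0‖ :=
    funext fun x => Complex.sin_arg _
  rw [this]
  exact (Complex.continuous_im.comp (continuous_coord hp 0)).div (continuous_coord hp 0).norm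
    fun x => norm_ne_zero_iff.2 (h0 x)

/-! ### The cutoff -/

/-- A function of the angle that is `1` for angles in `[0, 1]` and `0` for angles in `[2, 4]`. -/
def cutoff (θ : ℝ) : unitInterval :=
  projIcc 0 1 zero_le_one (2 * Real.cos (θ - 1 / 2) - 1 / 2)

theorem cutoff_congr {θ θ' : ℝ} (hc : Real.cos θ = Real.cos θ') (hs : Real.sin θ = Real.sin θ') :
    cutoff θ = cutoff θ' := by
  rw [cutoff, cutoff, Real.cos_sub, Real.cos_sub, hc, hs]

theorem cutoff_eq_one {θ : ℝ} (h : θ ∈ Icc (0 : ℝ) 1) : cutoff θ = 1 := by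
  refine projIcc_of_right_le _ ?_
  have h1 := Real.one_sub_sq_div_two_le_cos (x := θ - 1 / 2)
  nlinarith [h.1, h.2, mul_nonneg h.1 (sub_nonneg.2 h.2)]

theorem cutoff_eq_zero {θ : ℝ} (h : θ ∈ Icc (2 : ℝ) 4) : cutoff θ = 0 := by
  refine projIcc_of_le_left _ ?_
  -- The argument is in `[3/2, 7/2]`: past `π/2` the cosine is nonpositive, before it `cos x ≤ π/2 -
  -- x ≤ π/2 - 3/2`.
  suffices Real.cos (θ - 1 / 2) ≤ 1 / 4 by linarith
  have h1 := Real.pi_gt_three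
  have h2 := Real.pi_lt_d2
  rcases le_total (Real.pi / 2) (θ - 1 / 2) with hle | hle
  · exact (Real.cos_nonpos_of_pi_div_two_le_of_le hle (by linarith [h.2])).trans (by norm_num)
  · rw [← Real.sin_pi_div_two_sub]
    refine (Real.sin_le (sub_nonneg.2 hle)).trans ?_
    linarith [h.1]

/-! ### Interpolation of order isomorphisms -/

theorem strictMono_interp (ψ : ℝ ≃o ℝ) (s : unitInterval) :
    StrictMono fun x => (1 - (s : ℝ)) * x + s * ψ x := fun x y h => by
  have h1 := ψ.strictMono h
  have h2 := s.2.1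
  have h3 := s.2.2
  simp only
  nlinarith [mul_nonneg h2 (sub_nonneg.2 h1.le), mul_nonneg (sub_nonneg.2 h3) (sub_nonneg.2 h.le)]

theorem surjective_interp (ψ : ℝ ≃o ℝ) (s : unitInterval) :
    Function.Surjective fun x => (1 - (s : ℝ)) * x + s * ψ x := fun y => by
  have h2 := s.2.1
  have h3 := s.2.2
  have hc : Continuous ψ := ψ.continuous
  refine mem_range_of_exists_le_of_exists_ge (by fun_prop)
    -- At the minimum both the identity and `ψ` are at most `y`, at the maximum both are at least
    -- `y`; so are their convex combinations.
    ⟨min y (ψ.symm y), ?_⟩ ⟨max y (ψ.symm y), ?_⟩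
  · have h4 : ψ (min y (ψ.symm y)) ≤ y :=
      (ψ.monotone (min_le_right _ _)).trans_eq (ψ.apply_symm_apply y)
    have h5 := min_le_left y (ψ.symm y)
    nlinarith [mul_nonneg h2 (sub_nonneg.2 h4), mul_nonneg (sub_nonneg.2 h3) (sub_nonneg.2 h5)]
  · have h4 : y ≤ ψ (max y (ψ.symm y)) :=
      (ψ.apply_symm_apply y).symm.trans_le (ψ.monotone (le_max_right _ _))
    have h5 := le_max_left y (ψ.symm y)
    nlinarith [mul_nonneg h2 (sub_nonneg.2 h4), mul_nonneg (sub_nonneg.2 h3) (sub_nonneg.2 h5)]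

/-- The linear interpolation between the identity and an order isomorphism of the line. -/
def interp (ψ : ℝ ≃o ℝ) (s : unitInterval) : ℝ ≃o ℝ :=
  (strictMono_interp ψ s).orderIsoOfSurjective _ (surjective_interp ψ s)

theorem interp_apply (ψ : ℝ ≃o ℝ) (s : unitInterval) (x : ℝ) :
    interp ψ s x = (1 - (s : ℝ)) * x + s * ψ x := rfl

@[simp]
theorem interp_zero (ψ : ℝ ≃o ℝ) (x : ℝ) : interp ψ 0 x = x := by simp [interp_apply]

@[simp]
theorem interp_one (ψ : ℝ ≃o ℝ) (x : ℝ) : interp ψ 1 x = ψ x := by simp [interp_apply]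

theorem interp_fixed {ψ : ℝ ≃o ℝ} {x : ℝ} (h : ψ x = x) (s : unitInterval) :
    interp ψ s x = x := by
  rw [interp_apply, h]; ring

theorem continuous_interp (ψ : ℝ ≃o ℝ) :
    Continuous fun q : unitInterval × ℝ => interp ψ q.1 q.2 := by
  have hc : Continuous ψ := ψ.continuous
  simp only [interp_apply]
  fun_prop

/-- The condition `a < (E x).symm y` reads `E x a < y`, which is open in `(x, y)`; similarly for the
other rays. -/
theorem continuous_orderIso_symm {X : Type*} [TopologicalSpace X] {E : X → ℝ ≃o ℝ}
    (hE : Continuous fun q : X × ℝ => E q.1 q.2) :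
    Continuous fun q : X × ℝ => (E q.1).symm q.2 := by
  refine continuous_iff_continuousAt.2 fun q => tendsto_order.2 ⟨fun a ha => ?_, fun a ha => ?_⟩
  · have hE' : Continuous fun r : X × ℝ => E r.1 a := hE.comp (continuous_fst.prodMk continuous_const)
    filter_upwards [hE'.continuousAt.eventually_lt continuous_snd.continuousAt
      ((E q.1).lt_symm_apply.1 ha)] with r hr
    exact (E r.1).lt_symm_apply.2 hr
  · have hE' : Continuous fun r : X × ℝ => E r.1 a := hE.comp (continuous_fst.prodMk continuous_const)
    filter_upwards [continuous_snd.continuousAt.eventually_lt hE'.continuousAt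
      ((E q.1).symm_apply_lt.1 ha)] with r hr
    exact (E r.1).symm_apply_lt.2 hr

/-! ### The isotopy -/

/-- Move the columns by `E` and the heights by `F`, slowed down by the cutoff. -/
def move (E F : unitInterval → ℝ ≃o ℝ) (t : unitInterval) (p : S3) : S3 :=
  place (E (t * cutoff (angle p)) (planeX p), F (t * cutoff (angle p)) (planeY p), angle p)

theorem move_place (E F : unitInterval → ℝ ≃o ℝ) (t : unitInterval) (a b θ : ℝ) :
    move E F t (place (a, b, θ)) = place (E (t * cutoff θ) a, F (t * cutoff θ) b, θ) := by
  rw [move, cutoff_congr (cos_angle_place a b θ) (sin_angle_place a b θ), planeX_place,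
    planeY_place]
  exact place_congr (cos_angle_place a b θ) (sin_angle_place a b θ)

/-- On `unknotU` the coordinates are default values and `move` has no geometric meaning; it is used
only on the complement, which this keeps invariant. -/
theorem move_notMem_unknotU (E F : unitInterval → ℝ ≃o ℝ) (t : unitInterval) (p : S3) :
    move E F t p ∉ unknotU := place_notMem_unknotU _

/-- Moving preserves the angle up to full turns, hence the cutoff, so the inverse can be taken
separately at each angle. -/
theorem move_symm_move (E F : unitInterval → ℝ ≃o ℝ) (t : unitInterval) {p : S3}
    (hp : p ∉ unknotU) :
    move (fun s => (E s).symm) (fun s => (F s).symm) t (move E F t p) = p := by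
  conv_lhs => rw [← place_coords hp, move_place, move_place]
  simp only [OrderIso.symm_apply_apply]
  exact place_coords hp

theorem continuous_move {E F : unitInterval → ℝ ≃o ℝ}
    (hE : Continuous fun q : unitInterval × ℝ => E q.1 q.2)
    (hF : Continuous fun q : unitInterval × ℝ => F q.1 q.2) {X : Type*} [TopologicalSpace X]
    {t : X → unitInterval} {p : X → S3} (ht : Continuous t) (hp : Continuous p)
    (h0 : ∀ x, p x ∉ unknotU) : Continuous fun x => move E F (t x) (p x) := by
  have hc := continuous_cos_angle hp h0
  have hs := continuous_sin_angle hp h0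
  have hcut : Continuous fun x => cutoff (angle (p x)) := by
    simp only [cutoff, Real.cos_sub]
    exact continuous_projIcc.comp (by fun_prop)
  exact continuous_place (hE.comp ((ht.mul hcut).prodMk (continuous_planeX hp h0)))
    (hF.comp ((ht.mul hcut).prodMk (continuous_planeY hp h0))) hc hs

/-- Off `unknotU` the map is injective and it fixes `Z` there, so only points of `Z` can land in
`Z`. -/
theorem move_mem_compl {E F : unitInterval → ℝ ≃o ℝ} {Z : Set S3}
    {t : unitInterval} (hZ : ∀ p ∈ Z, p ∉ unknotU → move E F t p = p) {p : S3}
    (hp : p ∉ unknotU) (hpZ : p ∈ Zᶜ) : move E F t p ∈ Zᶜ := fun h => by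
  have h1 := hZ _ h (move_notMem_unknotU _ _ _ _)
  have h2 := move_symm_move E F t (move_notMem_unknotU E F t p)
  rw [h1, move_symm_move E F t hp] at h2
  exact hpZ (h2 ▸ h)

theorem move_symm_fixed {E F : unitInterval → ℝ ≃o ℝ} {t : unitInterval} {p : S3}
    (hp : p ∉ unknotU) (h : move E F t p = p) :
    move (fun s => (E s).symm) (fun s => (F s).symm) t p = p := by
  conv_lhs => rw [← h]
  exact move_symm_move E F t hp

/-- The homeomorphism of the complement of a set fixed by `move`. -/
def moveHomeomorph {E F : unitInterval → ℝ ≃o ℝ}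
    (hE : Continuous fun q : unitInterval × ℝ => E q.1 q.2)
    (hF : Continuous fun q : unitInterval × ℝ => F q.1 q.2) {Z : Set S3} (hU : unknotU ⊆ Z)
    (hZ : ∀ t, ∀ p ∈ Z, p ∉ unknotU → move E F t p = p) (t : unitInterval) :
    (Zᶜ : Set S3) ≃ₜ (Zᶜ : Set S3) where
  toFun p := ⟨move E F t p, move_mem_compl (hZ t) (fun h => p.2 (hU h)) p.2⟩
  invFun p := ⟨move (fun s => (E s).symm) (fun s => (F s).symm) t p,
    move_mem_compl (fun q hq hq' => move_symm_fixed hq' (hZ t q hq hq'))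
      (fun h => p.2 (hU h)) p.2⟩
  left_inv p := Subtype.ext (move_symm_move E F t fun h => p.2 (hU h))
  right_inv p := Subtype.ext (move_symm_move (fun s => (E s).symm) (fun s => (F s).symm) t
    fun h => p.2 (hU h))
  continuous_toFun := (continuous_move hE hF continuous_const continuous_subtype_val
    fun (p : (Zᶜ : Set S3)) h => p.2 (hU h)).subtype_mk _
  continuous_invFun := (continuous_move (continuous_orderIso_symm hE) (continuous_orderIso_symm hF)
    continuous_const continuous_subtype_val fun (p : (Zᶜ : Set S3)) h => p.2 (hU h)).subtype_mk _

theorem ambientIsotopicIn_of_move {E F : unitInterval → ℝ ≃o ℝ}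
    (hE : Continuous fun q : unitInterval × ℝ => E q.1 q.2)
    (hF : Continuous fun q : unitInterval × ℝ => F q.1 q.2) (hE0 : ∀ x, E 0 x = x)
    (hF0 : ∀ x, F 0 x = x) {Z : Set S3} (hU : unknotU ⊆ Z)
    (hZ : ∀ t, ∀ p ∈ Z, p ∉ unknotU → move E F t p = p) {A B : Set S3} (hA : A ⊆ Zᶜ)
    (hB : B ⊆ Zᶜ) (hAB : move E F 1 '' A = B) : AmbientIsotopicIn Zᶜ A B := by
  refine ⟨hA, hB, moveHomeomorph hE hF hU hZ, ?_, ?_, ?_⟩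
  · exact (continuous_move hE hF continuous_fst (continuous_subtype_val.comp continuous_snd)
      fun (q : unitInterval × (Zᶜ : Set S3)) h => q.2.2 (hU h)).subtype_mk _
  · ext p : 2
    change move E F 0 p = p
    rw [move, zero_mul, hE0, hF0]
    exact place_coords fun h => p.2 (hU h)
  · ext p
    constructor
    · rintro ⟨q, hq, rfl⟩
      exact hAB ▸ mem_image_of_mem _ hq
    · intro hp
      have hp' : (p : S3) ∈ move E F 1 '' A := hAB ▸ hp
      obtain ⟨q, hq, hqp⟩ := hp'
      exact ⟨⟨q, hA hq⟩, hq, Subtype.ext hqp⟩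

/-! ### The fixed link -/

/-- Only the angle range matters; by convexity it is inherited from the vertices. -/
theorem exists_of_mem_trefoilKnot {m n : ℕ} {p : S3} (h : p ∈ trefoilKnot m n) :
    ∃ a b θ : ℝ, θ ∈ Icc (2 : ℝ) 4 ∧ place (a, b, θ) = p := by
  obtain ⟨⟨a, b, θ⟩, hq, rfl⟩ := h
  refine ⟨a, b, θ, ?_, rfl⟩
  obtain ⟨i, hi⟩ := mem_iUnion.1 hq
  have hθ := (Prod.segment_subset _ _ (Prod.segment_subset _ _ hi).2).2
  refine (convex_Icc (2 : ℝ) 4).segment_subset ?_ ?_ hθ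
  · fin_cases i <;> norm_num
  · generalize finRotate 10 i = j
    fin_cases j <;> norm_num

theorem exists_of_mem_seifertLink {m n : ℕ} {p : S3} (h : p ∈ seifertLink m n)
    (hp : p ∉ unknotU) : ∃ (a b : ℤ) (θ : ℝ), a ∈ Finset.Icc (-(m : ℤ)) n ∧
      b ∈ Finset.Icc (-2 : ℤ) 2 ∧ place (a, b, θ) = p := by
  simp only [seifertLink, mem_union, mem_iUnion, mem_Icc] at h
  rcases h with (h | ⟨j, hj, ⟨θ, h⟩ | ⟨θ, h⟩⟩) | ⟨j, hj, ⟨θ, h⟩ | ⟨θ, h⟩⟩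
  · exact absurd h hp
  · exact ⟨-j, -2, θ, by simp; omega, by simp, by simpa using h⟩
  · exact ⟨-j, -1, θ, by simp; omega, by simp, by simpa using h⟩
  · exact ⟨j, 1, θ, by simp; omega, by simp, by simpa using h⟩
  · exact ⟨j, 2, θ, by simp; omega, by simp, by simpa using h⟩

theorem move_interp_fixed {m n : ℕ} {ψ φ : ℝ ≃o ℝ}
    (hψ : ∀ j ∈ Finset.Icc (-(m : ℤ)) n, ψ j = j) (hφ : ∀ j ∈ Finset.Icc (-2 : ℤ) 2, φ j = j)
    (t : unitInterval) {p : S3} (h : p ∈ seifertLink m n ∪ trefoilKnot m n) (hp : p ∉ unknotU) :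
    move (interp ψ) (interp φ) t p = p := by
  rcases h with h | h
  · obtain ⟨a, b, θ, ha, hb, rfl⟩ := exists_of_mem_seifertLink h hp
    rw [move_place, interp_fixed (hψ a ha), interp_fixed (hφ b hb)]
  · obtain ⟨a, b, θ, hθ, rfl⟩ := exists_of_mem_trefoilKnot h
    rw [move_place, cutoff_eq_zero hθ, mul_zero, interp_zero, interp_zero]

theorem place_notMem_link {m n : ℕ} {a b θ : ℝ} (hθ : θ ∈ Icc (0 : ℝ) 1)
    (hab : (∀ j : ℤ, a ≠ j) ∨ ∀ j : ℤ, b ≠ j) :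
    place (a, b, θ) ∉ seifertLink m n ∪ trefoilKnot m n := by
  rintro (h | h)
  · obtain ⟨j, j', θ', -, -, h⟩ := exists_of_mem_seifertLink h (place_notMem_unknotU _)
    have hx := congrArg planeX h
    have hy := congrArg planeY h
    simp only [planeX_place, planeY_place] at hx hy
    exact hab.elim (fun h => h j hx.symm) fun h => h j' hy.symm
  · obtain ⟨a', b', θ', hθ', h⟩ := exists_of_mem_trefoilKnot h
    -- The cutoff separates `[0, 1]` from `[2, 4]` on the circle, not merely on the line.
    have hc : cutoff θ' = cutoff θ := cutoff_congr
      (by rw [← cos_angle_place a' b', h, cos_angle_place])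
      (by rw [← sin_angle_place a' b', h, sin_angle_place])
    rw [cutoff_eq_zero hθ', cutoff_eq_one hθ] at hc
    exact zero_ne_one hc

/-! ### The image of a parent link -/

theorem image_uIcc_orderIso (ψ : ℝ ≃o ℝ) (a b : ℝ) : ψ '' uIcc a b = uIcc (ψ a) (ψ b) := by
  rw [uIcc, uIcc, ψ.image_Icc, map_inf, map_sup]

/-- The maps `ψ`, `φ` need not be affine, but a product of monotone maps still carries axis-parallel
segments to axis-parallel segments, and parent links consist only of these. -/
theorem image_segment_fst (ψ φ : ℝ ≃o ℝ) (a a' b c : ℝ) :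
    Prod.map ψ (Prod.map φ id) '' segment ℝ (a, b, c) (a', b, c) =
      segment ℝ (ψ a, φ b, c) (ψ a', φ b, c) := by
  rw [segment_prodMk_left, segment_prodMk_left, Set.prodMap_image_prod, image_uIcc_orderIso]
  simp

theorem image_segment_snd (ψ φ : ℝ ≃o ℝ) (a b b' c : ℝ) :
    Prod.map ψ (Prod.map φ id) '' segment ℝ (a, b, c) (a, b', c) =
      segment ℝ (ψ a, φ b, c) (ψ a, φ b', c) := by
  rw [← Prod.image_mk_segment_right, ← Prod.image_mk_segment_right, segment_prodMk_left,
    segment_prodMk_left, ← image_uIcc_orderIso, image_image, ← image_id {c},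
    ← Set.prodMap_image_prod, image_image]
  simp

theorem image_segment_trd (ψ φ : ℝ ≃o ℝ) (a b c c' : ℝ) :
    Prod.map ψ (Prod.map φ id) '' segment ℝ (a, b, c) (a, b, c') =
      segment ℝ (ψ a, φ b, c) (ψ a, φ b, c') := by
  rw [← Prod.image_mk_segment_right, ← Prod.image_mk_segment_right,
    ← Prod.image_mk_segment_right, ← Prod.image_mk_segment_right, image_image, image_image,
    image_image]
  simp

namespace ModularLink

variable {L : ModularLink}

/-- The set of coordinates of the points of a parent link. -/
def ParentDiagram.coords (D : L.ParentDiagram) : Set (ℝ × ℝ × ℝ) :=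
  ⋃ a : L.Label,
    segment ℝ (D.cx a, D.hx a, 1) (D.cy a, D.hx a, 1) ∪
    segment ℝ (D.cy a, D.hx a, 1) (D.cy a, D.hx a, 1/2) ∪
    segment ℝ (D.cy a, D.hx a, 1/2) (D.cy a, D.hy a, 1/2) ∪
    segment ℝ (D.cy a, D.hy a, 1/2) (D.cy a, D.hy a, 0) ∪
    segment ℝ (D.cy a, D.hy a, 0) (D.cx (L.next a), D.hy a, 0) ∪
    segment ℝ (D.cx (L.next a), D.hy a, 0) (D.cx (L.next a), D.hx (L.next a), 0) ∪
    segment ℝ (D.cx (L.next a), D.hx (L.next a), 0) (D.cx (L.next a), D.hx (L.next a), 1)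

theorem ParentDiagram.link_eq (D : L.ParentDiagram) : D.link = place '' D.coords := rfl

theorem ne_intCast_of_mem_Ioo {x : ℝ} {z : ℤ} (h : x ∈ Ioo (z : ℝ) (z + 1)) (j : ℤ) :
    x ≠ j := by
  rintro rfl
  have h1 : z < j := by exact_mod_cast h.1
  have h2 : j < z + 1 := by exact_mod_cast h.2
  omega

namespace ParentDiagram

variable (D : L.ParentDiagram)

theorem cx_ne_int (a : L.Label) (j : ℤ) : D.cx a ≠ j :=
  ne_intCast_of_mem_Ioo (z := -((L.xRank a : ℤ) + 1)) (by simpa using D.cx_mem a) j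

theorem cy_ne_int (a : L.Label) (j : ℤ) : D.cy a ≠ j :=
  ne_intCast_of_mem_Ioo (z := L.yRank a) (by simpa using D.cy_mem a) j

theorem hx_ne_int (a : L.Label) (j : ℤ) : D.hx a ≠ j :=
  ne_intCast_of_mem_Ioo (z := -2) (by have := D.hx_mem a; norm_num at this ⊢; exact this) j

theorem hy_ne_int (a : L.Label) (j : ℤ) : D.hy a ≠ j :=
  ne_intCast_of_mem_Ioo (z := 1) (by have := D.hy_mem a; norm_num at this ⊢; exact this) j

/-- Each of the seven segments has a constant plane coordinate that is not an integer, which keeps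
it off the fibres over integer points. -/
theorem coords_spec {a b θ : ℝ} (h : (a, b, θ) ∈ D.coords) :
    θ ∈ Icc (0 : ℝ) 1 ∧ ((∀ j : ℤ, a ≠ j) ∨ ∀ j : ℤ, b ≠ j) := by
  have key : ∀ {a₁ b₁ c₁ a₂ b₂ c₂ : ℝ}, c₁ ∈ Icc (0 : ℝ) 1 → c₂ ∈ Icc (0 : ℝ) 1 →
      (a₁ = a₂ ∧ ∀ j : ℤ, a₁ ≠ j) ∨ (b₁ = b₂ ∧ ∀ j : ℤ, b₁ ≠ j) →
      (a, b, θ) ∈ segment ℝ (a₁, b₁, c₁) (a₂, b₂, c₂) →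
      θ ∈ Icc (0 : ℝ) 1 ∧ ((∀ j : ℤ, a ≠ j) ∨ ∀ j : ℤ, b ≠ j) := by
    intro a₁ b₁ c₁ a₂ b₂ c₂ h₁ h₂ h hs
    have hs1 := Prod.segment_subset _ _ hs
    have hs2 := Prod.segment_subset _ _ hs1.2
    refine ⟨(convex_Icc (0 : ℝ) 1).segment_subset h₁ h₂ hs2.2, h.imp ?_ ?_⟩
    · rintro ⟨rfl, hj⟩
      have : a = a₁ := by simpa using hs1.1
      rwa [this]
    · rintro ⟨rfl, hj⟩
      have : b = b₁ := by simpa using hs2.1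
      rwa [this]
  have i0 : (0 : ℝ) ∈ Icc (0 : ℝ) 1 := by norm_num
  have i1 : (1 : ℝ) ∈ Icc (0 : ℝ) 1 := by norm_num
  have ih : (1 / 2 : ℝ) ∈ Icc (0 : ℝ) 1 := by norm_num
  obtain ⟨x, hx⟩ := mem_iUnion.1 h
  rcases hx with (((((h | h) | h) | h) | h) | h) | h
  · exact key i1 i1 (Or.inr ⟨rfl, D.hx_ne_int x⟩) h
  · exact key i1 ih (Or.inr ⟨rfl, D.hx_ne_int x⟩) h
  · exact key ih ih (Or.inl ⟨rfl, D.cy_ne_int x⟩) h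
  · exact key ih i0 (Or.inl ⟨rfl, D.cy_ne_int x⟩) h
  · exact key i0 i0 (Or.inr ⟨rfl, D.hy_ne_int x⟩) h
  · exact key i0 i0 (Or.inl ⟨rfl, D.cx_ne_int _⟩) h
  · exact key i0 i1 (Or.inl ⟨rfl, D.cx_ne_int _⟩) h

theorem link_subset (m n : ℕ) : D.link ⊆ (seifertLink m n ∪ trefoilKnot m n)ᶜ := by
  rw [link_eq]
  rintro _ ⟨⟨a, b, θ⟩, h, rfl⟩
  exact place_notMem_link (D.coords_spec h).1 (D.coords_spec h).2

theorem image_move_link (ψ φ : ℝ ≃o ℝ) :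
    move (interp ψ) (interp φ) 1 '' D.link = place '' (Prod.map ψ (Prod.map φ id) '' D.coords) := by
  rw [link_eq, image_image, image_image]
  refine image_congr ?_
  rintro ⟨a, b, θ⟩ h
  rw [move_place, cutoff_eq_one (D.coords_spec h).1, mul_one, interp_one, interp_one]
  rfl

end ParentDiagram

theorem image_coords {L₁ L₂ : ModularLink} {e : L₁.Label ≃ L₂.Label}
    (he : ∀ a, e (L₁.next a) = L₂.next (e a)) {D₁ : L₁.ParentDiagram} {D₂ : L₂.ParentDiagram}
    {ψ φ : ℝ ≃o ℝ} (hcx : ∀ a, ψ (D₁.cx a) = D₂.cx (e a)) (hcy : ∀ a, ψ (D₁.cy a) = D₂.cy (e a))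
    (hhx : ∀ a, φ (D₁.hx a) = D₂.hx (e a)) (hhy : ∀ a, φ (D₁.hy a) = D₂.hy (e a)) :
    Prod.map ψ (Prod.map φ id) '' D₁.coords = D₂.coords := by
  rw [ParentDiagram.coords, ParentDiagram.coords, image_iUnion]
  simp only [image_union, image_segment_fst, image_segment_snd, image_segment_trd, hcx, hcy, hhx,
    hhy, he]
  exact e.surjective.iUnion_comp fun a =>
    segment ℝ (D₂.cx a, D₂.hx a, 1) (D₂.cy a, D₂.hx a, 1) ∪
    segment ℝ (D₂.cy a, D₂.hx a, 1) (D₂.cy a, D₂.hx a, 1/2) ∪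
    segment ℝ (D₂.cy a, D₂.hx a, 1/2) (D₂.cy a, D₂.hy a, 1/2) ∪
    segment ℝ (D₂.cy a, D₂.hy a, 1/2) (D₂.cy a, D₂.hy a, 0) ∪
    segment ℝ (D₂.cy a, D₂.hy a, 0) (D₂.cx (L₂.next a), D₂.hy a, 0) ∪
    segment ℝ (D₂.cx (L₂.next a), D₂.hy a, 0) (D₂.cx (L₂.next a), D₂.hx (L₂.next a), 0) ∪
    segment ℝ (D₂.cx (L₂.next a), D₂.hx (L₂.next a), 0) (D₂.cx (L₂.next a), D₂.hx (L₂.next a), 1)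

end ModularLink

end

theorem mainTheorem10 (L₁ L₂ : ModularLink) (h : ModularLink.SameBaseOrders L₁ L₂) :
    L₁.sfLink = L₂.sfLink ∧ L₁.trefoil = L₂.trefoil ∧
    (∃ K, L₁.IsParentLink K) ∧ (∃ K, L₂.IsParentLink K) ∧
    ∀ K₁ K₂ : Set S3, L₁.IsParentLink K₁ → L₂.IsParentLink K₂ →
      AmbientIsotopicIn (L₁.sfLink ∪ L₁.trefoil)ᶜ K₁ K₂ := by
  obtain ⟨cx, cy, e, he, hx, hy⟩ := h.exists_equiv
  refine ⟨by rw [ModularLink.sfLink, ModularLink.sfLink, cx, cy],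
    by rw [ModularLink.trefoil, ModularLink.trefoil, cx, cy], ?_, ?_, ?_⟩
  · obtain ⟨D⟩ := L₁.exists_parentDiagram
    exact ⟨_, D, rfl⟩
  · obtain ⟨D⟩ := L₂.exists_parentDiagram
    exact ⟨_, D, rfl⟩
  · rintro _ _ ⟨D₁, rfl⟩ ⟨D₂, rfl⟩
    obtain ⟨ψ, hcx, hcy, hψ⟩ := ModularLink.exists_orderIso_columns he hx hy D₁ D₂
      -- These integers are the columns of all the annuli (and 0); those from -2 to 2 below include
      -- all heights of their boundary circles.
      (Finset.Icc (-(L₁.xExponents.card : ℤ)) L₁.yExponents.card)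
    obtain ⟨φ, hhx, hhy, hφ⟩ := ModularLink.exists_orderIso_heights he hx hy D₁ D₂
      (Finset.Icc (-2 : ℤ) 2)
    refine ambientIsotopicIn_of_move (continuous_interp ψ) (continuous_interp φ) (interp_zero ψ)
      (interp_zero φ) (fun p hp => Or.inl (Or.inl (Or.inl hp)))
      (fun t p hp hp' => move_interp_fixed hψ hφ t hp hp') (D₁.link_subset _ _)
      (D₂.link_subset _ _) ?_
    rw [D₁.image_move_link, ModularLink.image_coords he hcx hcy hhx hhy, D₂.link_eq]
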